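/- Let $(Q,N,C_1,C_2,\dots)$ be a random vector with $Q$ and all $C_i$ real-valued and $N\in\{0,1,2,\dots\}$, and put $\rho_\gamma=E\big[\sum_{i=1}^N|C_i|^\gamma\big]$ for $\gamma>0$. Let $\beta>1$ be such that $E[|Q|^\beta]<\infty$ and $E\big[\big(\sum_{i=1}^N|C_i|\big)^\beta\big]<\infty$, and assume that either (i) $\max(\rho_1,\rho_\beta)<1$, or (ii) $\beta=2$, $\rho_1=1$, $\rho_\beta<1$ and $E[Q]=0$. Weighted branching process: let $U=\bigcup_{n\ge0}\{1,2,\dots\}^n$ and let $\{(Q_{\mathbf i},N_{\mathbf i},C_{(\mathbf i,1)},C_{(\mathbf i,2)},\dots)\}_{\mathbf i\in U}$ be i.i.d. copies of $(Q,N,C_1,C_2,\dots)$. Set $A_0=\{\emptyset\}$, $A_n=\{(\mathbf i,r):\mathbf i\in A_{n-1},\,1\le r\le N_{\mathbf i}\}$ for $n\ge1$, $\Pi_\emptyset=1$, $\Pi_{(\mathbf i,r)}=C_{(\mathbf i,r)}\Pi_{\mathbf i}$, and $$R^{(k)}=\sum_{j=0}^k\sum_{\mathbf i\in A_j}Q_{\mathbf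 i}\Pi_{\mathbf i},\qquad k\ge0.$$ Bootstrap pools: for $m\ge1$ let $\{(Q^{j}_i,N^{j}_i,C^{j}_{(i,1)},C^{j}_{(i,2)},\dots)\}_{j\ge0,\,1\le i\le m}$ be i.i.d. copies of $(Q,N,C_1,C_2,\dots)$, and, independently of them, let $\{s^{j}_{i,r}\}_{j\ge1,\,1\le i\le m,\,r\ge1}$ be i.i.d. uniform on $\{1,\dots,m\}$ (the joint behaviour for different $m$ is arbitrary). Set $\hat R^{(0,m)}_i=Q^{0}_i$ and, for $j\ge1$, $$\hat R^{(j,m)}_i=\sum_{r=1}^{N^{j}_i}C^{j}_{(i,r)}\,\hat R^{(j-1,m)}_{s^{j}_{i,r}}+Q^{j}_i,\qquad 1\le i\le m,$$ that is, the values on the right are sampled uniformly with replacement from the previous pool. Let $h:\mathbb R\to\mathbb R$ be continuous with $|h(x)|\le C(1+|x|)$ for all $x\in\mathbb R$ and some constant $C>0$. Then, for every $k\ge0$, the variables $h(R^{(k)})$ and $\frac1m\sum_{i=1}^m h(\hat R^{(k,m)}_i)$ are integrable, and $$\frac1m\sum_{i=1}^m h\big(\hat R^{(k,m)}_i\big)\;\longrightarrow\;E\big[h(R^{(k)})\big]\qquad\text{as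 } m\to\infty$$ in $L^1$, and hence in probability; that is, the pool average is a consistent estimator of $E[h(R^{(k)})]$. -/

import Mathlib

open MeasureTheory ProbabilityTheory Filter Topology
open scoped ENNReal

noncomputable section

namespace BranchingBootstrap

/-- The value space of a branching vector `(Q, N, C₁, C₂, …)`. The weights are indexed from `0`:
the entry `r` of the last component is `C_{r+1}`. -/
abbrev BranchVec : Type := ℝ × ℕ × (ℕ → ℝ)

/-- The component `Q`. -/
def BranchVec.Q (v : BranchVec) : ℝ := v.1

/-- The component `N`. -/
def BranchVec.N (v : BranchVec) : ℕ := v.2.1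

/-- The weights `C₁, C₂, …`, indexed from `0`. -/
def BranchVec.C (v : BranchVec) (r : ℕ) : ℝ := v.2.2 r

/-- `ρ_β = E[∑_{i=1}^N |C_i|^β]` for a generic branching vector of law `ν`. -/
def rho (ν : Measure BranchVec) (β : ℝ) : ℝ≥0∞ :=
  ∫⁻ v, ENNReal.ofReal (∑ r ∈ Finset.range (BranchVec.N v), |BranchVec.C v r| ^ β) ∂ν

/-- The moment conditions with exponent `β` on the law `ν` of the generic branching vector:
`E|Q|^β < ∞`, `E[(∑_{i=1}^N |C_i|)^β] < ∞`, and either (i) `ρ₁ ∨ ρ_β < 1`, or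
(ii) `β = 2`, `ρ₁ = 1`, `ρ_β < 1` and `E[Q] = 0`. -/
structure MomentConditions (ν : Measure BranchVec) (β : ℝ) : Prop where
  one_le : 1 ≤ β
  moment_Q : ∫⁻ v, ENNReal.ofReal (|BranchVec.Q v| ^ β) ∂ν < ∞
  moment_C : ∫⁻ v, ENNReal.ofReal
    ((∑ r ∈ Finset.range (BranchVec.N v), |BranchVec.C v r|) ^ β) ∂ν < ∞
  contraction : max (rho ν 1) (rho ν β) < 1 ∨
    (β = 2 ∧ rho ν 1 = 1 ∧ rho ν β < 1 ∧ ∫ v, BranchVec.Q v ∂ν = 0)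

/-! ### The weighted branching process

A node `(i₁, …, i_n)` is the list `[i_n - 1, …, i₁ - 1]`, the most recent index first, so that
`[]` is the root and `r :: i` is the `r`-th child `(i, r + 1)` of the node `i`. A realization of
the tree assigns a branching vector `v i = (Q_i, N_i, C_{(i,1)}, C_{(i,2)}, …)` to every node. -/

/-- The `n`-th generation `A_n` of the tree. -/
def generation (v : List ℕ → BranchVec) : ℕ → Finset (List ℕ)
  | 0 => {[]}
  | n + 1 => (generation v n).biUnion fun i =>
      (Finset.range (BranchVec.N (v i))).image fun r => r :: i

/-- The weight `Π_i` of a node: `Π_∅ = 1` and `Π_{(i,r)} = C_{(i,r)} Π_i`. -/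
def weight (v : List ℕ → BranchVec) : List ℕ → ℝ
  | [] => 1
  | r :: i => BranchVec.C (v i) r * weight v i

/-- `R^{(k)} = ∑_{j=0}^k ∑_{i ∈ A_j} Q_i Π_i`. -/
def treeSum (v : List ℕ → BranchVec) (k : ℕ) : ℝ :=
  ∑ j ∈ Finset.range (k + 1), ∑ i ∈ generation v j, BranchVec.Q (v i) * weight v i

/-- `V` is a family of i.i.d. branching vectors of law `ν`, indexed by the nodes. -/
structure IsBranchingFamily {Ω : Type*} [MeasurableSpace Ω] (P : Measure Ω)
    (ν : Measure BranchVec) (V : List ℕ → Ω → BranchVec) : Prop where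
  measurable : ∀ i, Measurable (V i)
  law : ∀ i, P.map (V i) = ν
  indep : iIndepFun V P

/-! ### The iterative bootstrap algorithm -/

/-- The sample pools produced by the algorithm with pool size `m`, as a function of its random
input: `b j i` is the branching vector simulated at level `j` for the `i`-th member of the pool,
and `s j i r` is the position in the pool of level `j - 1` from which the `r`-th value used for
the `i`-th member of the pool of level `j` is taken. -/
def pool {m : ℕ} (b : ℕ → Fin m → BranchVec) (s : ℕ → Fin m → ℕ → Fin m) : ℕ → Fin m → ℝ
  | 0, i => BranchVec.Q (b 0 i)
  | j + 1, i =>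
      (∑ r ∈ Finset.range (BranchVec.N (b (j + 1) i)),
        BranchVec.C (b (j + 1) i) r * pool b s j (s (j + 1) i r)) + BranchVec.Q (b (j + 1) i)

/-- The random input of a run of the algorithm with pool size `m`: the branching vectors are
i.i.d. of law `ν`, the resampling positions are i.i.d. uniform on the `m` positions, and the
two families are independent of each other. -/
structure IsBootstrapInput {Ω : Type*} [MeasurableSpace Ω] (P : Measure Ω)
    (ν : Measure BranchVec) {m : ℕ} (B : ℕ → Fin m → Ω → BranchVec)
    (S : ℕ → Fin m → ℕ → Ω → Fin m) : Prop where
  measurable_B : ∀ j i, Measurable (B j i)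
  measurable_S : ∀ j i r, Measurable (S j i r)
  law_B : ∀ j i, P.map (B j i) = ν
  law_S : ∀ j i r, P.map (S j i r) = uniformOn Set.univ
  indep_B : iIndepFun (fun (p : ℕ × Fin m) => B p.1 p.2) P
  indep_S : iIndepFun (fun (p : ℕ × Fin m × ℕ) => S p.1 p.2.1 p.2.2) P
  indep_B_S : IndepFun (fun ω (p : ℕ × Fin m) => B p.1 p.2 ω)
    (fun ω (p : ℕ × Fin m × ℕ) => S p.1 p.2.1 p.2.2 ω) P

/-- The estimator `(1/m) ∑_{i=1}^m h(R̂_i^{(k,m)})`. -/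
def poolAverage {Ω : Type*} (h : ℝ → ℝ) (k : ℕ) {m : ℕ} (B : ℕ → Fin m → Ω → BranchVec)
    (S : ℕ → Fin m → ℕ → Ω → Fin m) (ω : Ω) : ℝ :=
  (1 / (m : ℝ)) * ∑ i : Fin m, h (pool (fun j i => B j i ω) (fun j i r => S j i r ω) k i)

end BranchingBootstrap

end

/-! Two draws from a pool of size `m` pick the same position with probability `1 / m`, so finitely
many draws behave like the values at distinct positions, which have a joint law that does not depend
on the positions. By induction on the level `k`, finitely many values drawn from the pool of level
`k` therefore become i.i.d. with the law of `R^{(k)}`. Convergence is tested on functions of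
finitely many values with at most linear growth: for fixed branching vectors the recursion preserves
this class, and a first moment bound, uniform in `m`, allows dominated convergence in the vectors.

The second moment of the empirical mean of a function is the expectation of its product over two
draws. This settles bounded functions; those of linear growth are approximated in `L¹` by bounded
ones. -/

namespace BranchingBootstrap

open scoped NNReal

/-! ### One step of the recursion -/

section
variable {ι κ 𝓧 𝓨 : Type*} [MeasurableSpace 𝓧] [MeasurableSpace 𝓨]

lemma map_prod_left {𝓩 : Type*} [MeasurableSpace 𝓩] (μ : Measure 𝓧) [SFinite μ]
    (τ : Measure 𝓨) [SFinite τ] {f : 𝓧 → 𝓩} (hf : Measurable f) :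
    (μ.map f).prod τ = (μ.prod τ).map (Prod.map f id) := by
  rw [← Measure.map_prod_map μ τ hf measurable_id, Measure.map_id]

lemma prod_map_right {𝓩 : Type*} [MeasurableSpace 𝓩] (μ : Measure 𝓧) [SFinite μ]
    (τ : Measure 𝓨) [SFinite τ] {f : 𝓨 → 𝓩} (hf : Measurable f) :
    μ.prod (τ.map f) = (μ.prod τ).map (Prod.map id f) := by
  rw [← Measure.map_prod_map μ τ measurable_id hf, Measure.map_id]

lemma infinitePi_map_comp (μ : Measure 𝓧) [IsProbabilityMeasure μ] {e : ι → κ}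
    (he : Function.Injective e) : (Measure.infinitePi fun _ : κ => μ).map (· ∘ e) =
      Measure.infinitePi fun _ : ι => μ :=
  Measure.map_infinitePi_infinitePi_of_inj (P := fun _ : κ => μ) he

lemma infinitePi_prod_infinitePi_map_zip (μ : Measure 𝓧) [IsProbabilityMeasure μ]
    (τ : Measure 𝓨) [IsProbabilityMeasure τ] :
    ((Measure.infinitePi fun _ : ι => μ).prod (Measure.infinitePi fun _ : ι => τ)).map
      (fun p i => (p.1 i, p.2 i)) = Measure.infinitePi fun _ : ι => μ.prod τ := by
  refine IsProjectiveLimit.unique (fun I => ?_)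
    (Measure.isProjectiveLimit_infinitePi fun _ : ι => μ.prod τ)
  rw [← (measurePreserving_arrowProdEquivProdArrow 𝓧 𝓨 I (fun _ => μ) (fun _ => τ)).symm.map_eq,
    ← Measure.infinitePi_map_restrict (fun _ : ι => μ),
    ← Measure.infinitePi_map_restrict (fun _ : ι => τ),
    Measure.map_prod_map _ _ (by fun_prop) (by fun_prop),
    Measure.map_map (by fun_prop) (by fun_prop), Measure.map_map (by fun_prop) (by fun_prop)]
  rfl

lemma measurable_range_comp {F : ℕ → 𝓧 → 𝓨} (hF : ∀ n, Measurable (F n)) {N : 𝓧 → ℕ}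
    (hN : Measurable N) : Measurable fun a => F (N a) a := by
  have hF' : Measurable fun p : ℕ × 𝓧 => F p.1 p.2 := measurable_from_prod_countable_right hF
  exact hF'.comp (hN.prodMk measurable_id)

@[fun_prop]
lemma BranchVec.measurable_Q : Measurable BranchVec.Q := measurable_fst

@[fun_prop]
lemma BranchVec.measurable_N : Measurable BranchVec.N := measurable_snd.fst

@[fun_prop]
lemma BranchVec.measurable_C (r : ℕ) : Measurable fun v => BranchVec.C v r :=
  (measurable_pi_apply r).comp measurable_snd.snd

/-- The right-hand side `∑_{r ≤ N} C_r z_r + Q` of the recursion, for a branching vector `v` and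
values `z` of the children. -/
def branchStep (v : BranchVec) (z : ℕ → ℝ) : ℝ :=
  (∑ r ∈ Finset.range (BranchVec.N v), BranchVec.C v r * z r) + BranchVec.Q v

lemma measurable_branchStep :
    Measurable fun p : (ℕ → ℝ) × BranchVec => branchStep p.2 p.1 := by
  have hsum : Measurable fun p : (ℕ → ℝ) × BranchVec =>
      ∑ r ∈ Finset.range (BranchVec.N p.2), BranchVec.C p.2 r * p.1 r := by
    refine measurable_range_comp
      (F := fun n (p : (ℕ → ℝ) × BranchVec) => ∑ r ∈ Finset.range n, BranchVec.C p.2 r * p.1 r)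
      (fun n => Finset.measurable_sum _ fun r _ => ?_) (by fun_prop)
    exact Measurable.mul (by fun_prop) (by fun_prop)
  exact hsum.add (by fun_prop)

/-- The smoothing transform: the law of `∑_{r ≤ N} C_r z_r + Q`, where `(Q, N, C)` has law `ν` and
the `z_r` are independent of it and i.i.d. of law `μ`. -/
noncomputable def smoothing (ν : Measure BranchVec) (μ : Measure ℝ) : Measure ℝ :=
  ((Measure.infinitePi fun _ : ℕ => μ).prod ν).map fun p => branchStep p.2 p.1

instance (ν : Measure BranchVec) [IsProbabilityMeasure ν] (μ : Measure ℝ)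
    [IsProbabilityMeasure μ] : IsProbabilityMeasure (smoothing ν μ) :=
  Measure.isProbabilityMeasure_map measurable_branchStep.aemeasurable

/-- One step of the recursion at every node of `ι` at once: `z (a, r)` is the value of the `r`-th
child of the node `a`, and `v a` is the branching vector at `a`. -/
def forestMap (p : (ι × ℕ → ℝ) × (ι → BranchVec)) (a : ι) : ℝ :=
  branchStep (p.2 a) fun r => p.1 (a, r)

lemma measurable_forestMap : Measurable (forestMap (ι := ι)) :=
  measurable_pi_lambda _ fun a => measurable_branchStep.comp
    (f := fun p : (ι × ℕ → ℝ) × (ι → BranchVec) => (fun r => p.1 (a, r), p.2 a)) (by fun_prop)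

/-- The joint law of the values at the nodes of `ι` when the joint law of the values of their
children is `Λ` and the nodes carry independent branching vectors of law `ν`. -/
noncomputable def forestStep (ν : Measure BranchVec) (Λ : Measure (ι × ℕ → ℝ)) : Measure (ι → ℝ) :=
  (Λ.prod (Measure.infinitePi fun _ : ι => ν)).map forestMap

section
variable (ν : Measure BranchVec) [IsProbabilityMeasure ν]

instance (Λ : Measure (ι × ℕ → ℝ)) [IsProbabilityMeasure Λ] :
    IsProbabilityMeasure (forestStep ν Λ) :=
  Measure.isProbabilityMeasure_map measurable_forestMap.aemeasurable

lemma forestStep_infinitePi (μ : Measure ℝ) [IsProbabilityMeasure μ] :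
    forestStep ν (Measure.infinitePi fun _ : ι × ℕ => μ) =
      Measure.infinitePi fun _ : ι => smoothing ν μ := by
  have hzip : Measurable fun (p : (ι → ℕ → ℝ) × (ι → BranchVec)) i => (p.1 i, p.2 i) := by
    fun_prop
  have hstep : Measurable fun (y : ι → (ℕ → ℝ) × BranchVec) i => branchStep (y i).2 (y i).1 :=
    measurable_pi_lambda _ fun i => measurable_branchStep.comp (measurable_pi_apply i)
  simp only [forestStep, smoothing]
  rw [← Measure.infinitePi_map_pi (fun _ : ι => (Measure.infinitePi fun _ : ℕ => μ).prod ν)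
      (f := fun _ p => branchStep p.2 p.1) fun _ => measurable_branchStep,
    ← infinitePi_prod_infinitePi_map_zip,
    ← Measure.infinitePi_map_curry fun (_ : ι) (_ : ℕ) => μ, map_prod_left _ _ (by fun_prop),
    Measure.map_map hstep hzip, Measure.map_map (hstep.comp hzip) (by fun_prop)]
  rfl

lemma forestStep_map_comp {Λ : Measure (κ × ℕ → ℝ)} [SFinite Λ] {e : ι → κ}
    (he : Function.Injective e) :
    (forestStep ν Λ).map (· ∘ e) = forestStep ν (Λ.map (· ∘ Prod.map e id)) := by
  have hm : Measurable fun z : κ × ℕ → ℝ => z ∘ Prod.map e (id : ℕ → ℕ) := by fun_prop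
  have hm' : Measurable fun v : κ → BranchVec => v ∘ e := by fun_prop
  rw [forestStep, forestStep, ← infinitePi_map_comp ν he, Measure.map_prod_map _ _ hm hm',
    Measure.map_map (by fun_prop) measurable_forestMap,
    Measure.map_map measurable_forestMap (hm.prodMap hm')]
  rfl

end

end

/-! ### The law of the weighted branching process -/

lemma sum_generation_succ_top (v : List ℕ → BranchVec) (n : ℕ) (f : List ℕ → ℝ) :
    ∑ i ∈ generation v (n + 1), f i =
      ∑ i ∈ generation v n, ∑ r ∈ Finset.range (BranchVec.N (v i)), f (r :: i) := by
  rw [generation, Finset.sum_biUnion]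
  · refine Finset.sum_congr rfl fun i _ => ?_
    rw [Finset.sum_image]
    intro a _ b _ h
    exact (List.cons.inj h).1
  · intro i _ j _ hij
    simp only [Function.onFun, Finset.disjoint_left, Finset.mem_image]
    rintro _ ⟨r, _, rfl⟩ ⟨r', _, h⟩
    exact hij (List.cons.inj h).2.symm

lemma sum_generation_succ_root (n : ℕ) (v : List ℕ → BranchVec) (f : List ℕ → ℝ) :
    ∑ i ∈ generation v (n + 1), f i =
      ∑ r ∈ Finset.range (BranchVec.N (v [])),
        ∑ i ∈ generation (fun i => v (i ++ [r])) n, f (i ++ [r]) := by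
  induction n generalizing f with
  | zero => rw [sum_generation_succ_top]; simp [generation]
  | succ n ih =>
    rw [sum_generation_succ_top, ih]
    refine Finset.sum_congr rfl fun r _ => ?_
    rw [sum_generation_succ_top]
    simp

lemma weight_append_singleton (v : List ℕ → BranchVec) (r : ℕ) (i : List ℕ) :
    weight v (i ++ [r]) = BranchVec.C (v []) r * weight (fun i => v (i ++ [r])) i := by
  induction i with
  | nil => simp [weight]
  | cons a i ih => rw [List.cons_append, weight, ih, weight]; ring

lemma treeSum_zero (v : List ℕ → BranchVec) : treeSum v 0 = BranchVec.Q (v []) := by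
  simp [treeSum, generation, weight]

lemma treeSum_succ (v : List ℕ → BranchVec) (k : ℕ) :
    treeSum v (k + 1) = branchStep (v []) fun r => treeSum (fun i => v (i ++ [r])) k := by
  rw [treeSum, Finset.sum_range_succ', branchStep]
  congr 1
  · simp_rw [treeSum, sum_generation_succ_root, weight_append_singleton, Finset.mul_sum]
    rw [Finset.sum_comm]
    refine Finset.sum_congr rfl fun r _ => Finset.sum_congr rfl fun j _ =>
      Finset.sum_congr rfl fun i _ => by ring
  · simp [generation, weight]

/-- The splitting of a labelled tree into the subtrees of the children of the root and the root
vector. -/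
def splitRoot (v : List ℕ → BranchVec) : (ℕ → List ℕ → BranchVec) × BranchVec :=
  (fun r i => v (i ++ [r]), v [])

lemma measurable_splitRoot : Measurable splitRoot :=
  Measurable.prodMk (measurable_pi_lambda _ fun _ => measurable_pi_lambda _ fun _ =>
    measurable_pi_apply _) (measurable_pi_apply _)

lemma measurable_treeSum (k : ℕ) : Measurable fun v : List ℕ → BranchVec => treeSum v k := by
  induction k with
  | zero => simp only [treeSum_zero]; fun_prop
  | succ k ih =>
    simp only [treeSum_succ]
    have hsub : Measurable fun (w : ℕ → List ℕ → BranchVec) r => treeSum (w r) k :=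
      measurable_pi_lambda _ fun r => ih.comp (measurable_pi_apply r)
    exact measurable_branchStep.comp ((hsub.prodMap measurable_id).comp measurable_splitRoot)

/-- The laws of the `R^{(k)}`: the iterates of the smoothing transform on the law of `Q`. -/
noncomputable def treeLaw (ν : Measure BranchVec) : ℕ → Measure ℝ
  | 0 => ν.map BranchVec.Q
  | k + 1 => smoothing ν (treeLaw ν k)

instance (ν : Measure BranchVec) [IsProbabilityMeasure ν] (k : ℕ) :
    IsProbabilityMeasure (treeLaw ν k) := by
  induction k with
  | zero => exact Measure.isProbabilityMeasure_map BranchVec.measurable_Q.aemeasurable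
  | succ k ih => rw [treeLaw]; infer_instance

lemma comap_pi_le_iSup_range {Ω α ι 𝓧 : Type*} [MeasurableSpace 𝓧] (X : ι → Ω → 𝓧) (f : α → ι) :
    MeasurableSpace.comap (fun ω a => X (f a) ω) MeasurableSpace.pi ≤
      ⨆ i ∈ Set.range f, MeasurableSpace.comap (X i) inferInstance := by
  rw [MeasurableSpace.pi, MeasurableSpace.comap_iSup]
  refine iSup_le fun a => ?_
  rw [MeasurableSpace.comap_comp]
  exact le_iSup₂_of_le (f a) ⟨a, rfl⟩ le_rfl

lemma indepFun_of_disjoint_range {Ω α γ ι 𝓧 : Type*} [MeasurableSpace Ω] [MeasurableSpace 𝓧]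
    {P : Measure Ω} {X : ι → Ω → 𝓧} (hX : ∀ i, Measurable (X i)) (hind : iIndepFun X P)
    {f : α → ι} {g : γ → ι} (hfg : Disjoint (Set.range f) (Set.range g)) :
    IndepFun (fun ω a => X (f a) ω) (fun ω c => X (g c) ω) P := by
  have hindep := indep_iSup_of_disjoint (fun i => (hX i).comap_le) hind.iIndep hfg
  rw [IndepFun_iff_Indep]
  exact indep_of_indep_of_le_left
    (indep_of_indep_of_le_right hindep (comap_pi_le_iSup_range X g)) (comap_pi_le_iSup_range X f)

section
variable (ν : Measure BranchVec) [IsProbabilityMeasure ν]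

lemma infinitePi_map_splitRoot :
    (Measure.infinitePi fun _ : List ℕ => ν).map splitRoot =
      (Measure.infinitePi fun _ : ℕ => Measure.infinitePi fun _ : List ℕ => ν).prod ν := by
  have hsub : (fun v => (splitRoot v).1) =
      MeasurableEquiv.curry ℕ (List ℕ) BranchVec ∘ fun v p => v (p.2 ++ [p.1]) := rfl
  have hinj : Function.Injective fun p : ℕ × List ℕ => p.2 ++ [p.1] := by
    rintro ⟨a, i⟩ ⟨b, j⟩ h
    have := List.append_inj' h rfl
    simp_all
  have hdisj : Disjoint (Set.range fun p : ℕ × List ℕ => p.2 ++ [p.1])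
      (Set.range fun _ : Unit => ([] : List ℕ)) :=
    Set.disjoint_range_iff.2 (by simp)
  have hind : IndepFun (fun v => (splitRoot v).1) (fun v => (splitRoot v).2)
      (Measure.infinitePi fun _ : List ℕ => ν) :=
    (indepFun_of_disjoint_range (fun i => measurable_pi_apply i)
      (iIndepFun_infinitePi (X := fun _ x => x) fun _ => measurable_id) hdisj).comp
      (MeasurableEquiv.curry ℕ (List ℕ) BranchVec).measurable (measurable_pi_apply ())
  refine ((indepFun_iff_map_prod_eq_prod_map_map measurable_splitRoot.fst.aemeasurable
    measurable_splitRoot.snd.aemeasurable).1 hind).trans ?_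
  congr 1
  · rw [hsub, ← Measure.map_map (by fun_prop) (by fun_prop),
      Measure.map_infinitePi_infinitePi_of_inj (P := fun _ : List ℕ => ν) hinj,
      Measure.infinitePi_map_curry fun (_ : ℕ) (_ : List ℕ) => ν]
  · exact Measure.infinitePi_map_eval (fun _ : List ℕ => ν) []

lemma infinitePi_map_treeSum (k : ℕ) :
    (Measure.infinitePi fun _ : List ℕ => ν).map (fun v => treeSum v k) = treeLaw ν k := by
  induction k with
  | zero =>
    simp only [treeSum_zero, treeLaw]
    conv_rhs => rw [← Measure.infinitePi_map_eval (fun _ : List ℕ => ν) []]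
    rw [Measure.map_map (by fun_prop) (by fun_prop)]
    rfl
  | succ k ih =>
    have hsub : Measurable fun (w : ℕ → List ℕ → BranchVec) r => treeSum (w r) k :=
      measurable_pi_lambda _ fun r => (measurable_treeSum k).comp (measurable_pi_apply r)
    simp only [treeSum_succ]
    rw [treeLaw, smoothing, ← ih,
      ← Measure.infinitePi_map_pi (fun _ : ℕ => Measure.infinitePi fun _ : List ℕ => ν)
        (f := fun _ v => treeSum v k) (fun _ => measurable_treeSum k),
      map_prod_left _ _ hsub, ← infinitePi_map_splitRoot,
      Measure.map_map (hsub.prodMap measurable_id) measurable_splitRoot,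
      Measure.map_map measurable_branchStep
        ((hsub.prodMap measurable_id).comp measurable_splitRoot)]
    rfl

end

lemma IsBranchingFamily.measurePreserving_treeSum {Ω : Type*} [MeasurableSpace Ω] {P : Measure Ω}
    {ν : Measure BranchVec} [IsProbabilityMeasure ν] {V : List ℕ → Ω → BranchVec}
    (hV : IsBranchingFamily P ν V) (k : ℕ) :
    MeasurePreserving (fun ω => treeSum (fun i => V i ω) k) P (treeLaw ν k) := by
  have hmeas : Measurable fun ω i => V i ω := measurable_pi_iff.2 hV.measurable
  have hlaw := hV.indep.map_fun_eq_infinitePi_map hV.measurable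
  simp_rw [hV.law] at hlaw
  refine ⟨(measurable_treeSum k).comp hmeas, ?_⟩
  rw [← infinitePi_map_treeSum, ← hlaw, Measure.map_map (measurable_treeSum k) hmeas]
  rfl

/-! ### The law of the pools -/

lemma prod_prod_map_comm {α β γ δ : Type*} [MeasurableSpace α] [MeasurableSpace β]
    [MeasurableSpace γ] [MeasurableSpace δ] (a : Measure α) [SFinite a] (b : Measure β) [SFinite b]
    (c : Measure γ) [SFinite c] (d : Measure δ) [SFinite d] :
    ((a.prod b).prod (c.prod d)).map (fun p => ((p.1.1, p.2.1), (p.1.2, p.2.2))) =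
      (a.prod c).prod (b.prod d) := by
  refine Measure.ext_of_lintegral _ fun f hf => ?_
  rw [lintegral_map hf (by fun_prop), lintegral_prod _ (by fun_prop),
    lintegral_prod _ (by fun_prop), lintegral_prod _ (by fun_prop), lintegral_prod _ (by fun_prop)]
  refine lintegral_congr fun x => ?_
  have hinner : ∀ y, ∫⁻ q, f ((x, q.1), (y, q.2)) ∂(c.prod d) =
      ∫⁻ z, ∫⁻ w, f ((x, z), (y, w)) ∂d ∂c := fun y => lintegral_prod _ (by fun_prop)
  have hinner' : ∀ z, ∫⁻ q, f ((x, z), q) ∂(b.prod d) = ∫⁻ y, ∫⁻ w, f ((x, z), (y, w)) ∂d ∂b :=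
    fun z => lintegral_prod _ (by fun_prop)
  simp only [hinner, hinner']
  exact lintegral_lintegral_swap (Measurable.aemeasurable (by fun_prop))

lemma indepFun_prodMk_prodMk {Ω α β γ δ : Type*} [MeasurableSpace Ω] [MeasurableSpace α]
    [MeasurableSpace β] [MeasurableSpace γ] [MeasurableSpace δ] {P : Measure Ω}
    [IsFiniteMeasure P] {X : Ω → α} {Y : Ω → β} {Z : Ω → γ} {W : Ω → δ} (hX : Measurable X)
    (hY : Measurable Y) (hZ : Measurable Z) (hW : Measurable W) (hXY : IndepFun X Y P)
    (hZW : IndepFun Z W P) (h : IndepFun (fun ω => (X ω, Y ω)) (fun ω => (Z ω, W ω)) P) :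
    IndepFun (fun ω => (X ω, Z ω)) (fun ω => (Y ω, W ω)) P := by
  have hXZ : IndepFun X Z P := h.comp measurable_fst measurable_fst
  have hYW : IndepFun Y W P := h.comp measurable_snd measurable_snd
  rw [indepFun_iff_map_prod_eq_prod_map_map (by fun_prop) (by fun_prop)] at h hXY hZW hXZ hYW ⊢
  rw [hXZ, hYW, ← prod_prod_map_comm, ← hXY, ← hZW, ← h,
    Measure.map_map (by fun_prop) (by fun_prop)]
  rfl

section
variable {m : ℕ} {ι κ 𝓧 : Type*} [MeasurableSpace 𝓧]

lemma measurable_comp_fin : Measurable fun p : (Fin m → 𝓧) × (ι → Fin m) => p.1 ∘ p.2 := by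
  have heval : Measurable fun p : Fin m × (Fin m → 𝓧) => p.2 p.1 :=
    measurable_from_prod_countable_right fun i => measurable_pi_apply i
  exact measurable_pi_lambda _ fun i =>
    heval.comp (f := fun p : (Fin m → 𝓧) × (ι → Fin m) => (p.2 i, p.1)) (by fun_prop)

/-- The joint law of draws, indexed by `ι`, made uniformly with replacement from a random pool of
law `π`. -/
noncomputable def sampleLaw (π : Measure (Fin m → 𝓧)) (ι : Type*) : Measure (ι → 𝓧) :=
  (π.prod (Measure.infinitePi fun _ : ι => uniformOn Set.univ)).map fun p => p.1 ∘ p.2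

variable [NeZero m]

instance (π : Measure (Fin m → 𝓧)) [IsProbabilityMeasure π] :
    IsProbabilityMeasure (sampleLaw π ι) :=
  Measure.isProbabilityMeasure_map measurable_comp_fin.aemeasurable

lemma sampleLaw_map_comp (π : Measure (Fin m → 𝓧)) [SFinite π] {e : ι → κ}
    (he : Function.Injective e) : (sampleLaw π κ).map (· ∘ e) = sampleLaw π ι := by
  have hm : Measurable fun s : κ → Fin m => s ∘ e := by fun_prop
  rw [sampleLaw, sampleLaw, ← infinitePi_map_comp _ he, prod_map_right _ _ hm,
    Measure.map_map (by fun_prop) measurable_comp_fin,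
    Measure.map_map measurable_comp_fin (measurable_id.prodMap hm)]
  rfl

end

/-- The joint law of the values at distinct positions, indexed by `ι`, of the pool of level `k`
produced with pool size `m`. Keeping `ι` arbitrary allows more positions than the pool has. -/
noncomputable def poolLaw (ν : Measure BranchVec) (m : ℕ) : ℕ → (ι : Type) → Measure (ι → ℝ)
  | 0, _ => Measure.infinitePi fun _ => ν.map BranchVec.Q
  | k + 1, ι => forestStep ν (sampleLaw (poolLaw ν m k (Fin m)) (ι × ℕ))

section
variable {m : ℕ}

lemma pool_succ (b : ℕ → Fin m → BranchVec) (s : ℕ → Fin m → ℕ → Fin m) (k : ℕ) :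
    pool b s (k + 1) = forestMap (fun p => pool b s k (s (k + 1) p.1 p.2), b (k + 1)) := rfl

lemma pool_congr {b b' : ℕ → Fin m → BranchVec} {s s' : ℕ → Fin m → ℕ → Fin m} {k : ℕ}
    (hb : ∀ j ≤ k, b j = b' j) (hs : ∀ j ≤ k, s j = s' j) : pool b s k = pool b' s' k := by
  induction k with
  | zero => ext i; simp [pool, hb 0 le_rfl]
  | succ k ih =>
    rw [pool_succ, pool_succ, hb _ le_rfl, hs _ le_rfl,
      ih (fun j hj => hb j (hj.trans k.le_succ)) (fun j hj => hs j (hj.trans k.le_succ))]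

/-- The pool of level `k` as a function of the whole random input. -/
def inputPool (k : ℕ) (p : (ℕ × Fin m → BranchVec) × (ℕ × Fin m × ℕ → Fin m)) : Fin m → ℝ :=
  pool (fun j i => p.1 (j, i)) (fun j i r => p.2 (j, i, r)) k

lemma measurable_inputPool (k : ℕ) : Measurable (inputPool (m := m) k) := by
  induction k with
  | zero => exact measurable_pi_lambda _ fun i => BranchVec.measurable_Q.comp (by fun_prop)
  | succ k ih =>
    have hdraw : Measurable fun p : (ℕ × Fin m → BranchVec) × (ℕ × Fin m × ℕ → Fin m) =>
        inputPool k p ∘ fun q : Fin m × ℕ => p.2 (k + 1, q) :=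
      measurable_comp_fin.comp (ih.prodMk (by fun_prop))
    exact measurable_forestMap.comp (hdraw.prodMk (g := fun p i => p.1 (k + 1, i)) (by fun_prop))

end

section
variable {m : ℕ} {ι κ : Type} (ν : Measure BranchVec) [IsProbabilityMeasure ν]

instance [NeZero m] (k : ℕ) : IsProbabilityMeasure (poolLaw ν m k ι) := by
  induction k generalizing ι with
  | zero =>
    have : IsProbabilityMeasure (ν.map BranchVec.Q) :=
      Measure.isProbabilityMeasure_map BranchVec.measurable_Q.aemeasurable
    rw [poolLaw]; infer_instance
  | succ k ih => rw [poolLaw]; infer_instance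

lemma poolLaw_map_comp [NeZero m] (k : ℕ) {e : ι → κ} (he : Function.Injective e) :
    (poolLaw ν m k κ).map (· ∘ e) = poolLaw ν m k ι := by
  cases k with
  | zero =>
    have : IsProbabilityMeasure (ν.map BranchVec.Q) :=
      Measure.isProbabilityMeasure_map BranchVec.measurable_Q.aemeasurable
    exact infinitePi_map_comp _ he
  | succ k =>
    rw [poolLaw, forestStep_map_comp ν he,
      sampleLaw_map_comp _ (he.prodMap Function.injective_id), poolLaw]

end

namespace IsBootstrapInput

variable {Ω : Type*} [MeasurableSpace Ω] {P : Measure Ω} {ν : Measure BranchVec} {m : ℕ}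
  {B : ℕ → Fin m → Ω → BranchVec} {S : ℕ → Fin m → ℕ → Ω → Fin m}
  (h : IsBootstrapInput P ν B S)

include h

lemma measurable_input :
    Measurable fun ω => ((fun p : ℕ × Fin m => B p.1 p.2 ω),
      fun p : ℕ × Fin m × ℕ => S p.1 p.2.1 p.2.2 ω) :=
  (measurable_pi_lambda _ fun _ => h.measurable_B _ _).prodMk
    (measurable_pi_lambda _ fun _ => h.measurable_S _ _ _)

lemma measurable_pool (k : ℕ) :
    Measurable fun ω => pool (fun j i => B j i ω) (fun j i r => S j i r ω) k :=
  (measurable_inputPool k).comp h.measurable_input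

lemma indepFun_pool_succ (k : ℕ) :
    IndepFun (fun ω => pool (fun j i => B j i ω) (fun j i r => S j i r ω) k)
      (fun ω => ((fun q : Fin m × ℕ => S (k + 1) q.1 q.2 ω), fun i => B (k + 1) i ω)) P := by
  have := h.indep_B.isProbabilityMeasure
  have hdisj (α : Type) : Disjoint (Set.range fun q : ℕ × α => (min q.1 k, q.2))
      (Set.range fun a : α => (k + 1, a)) :=
    Set.disjoint_range_iff.2 fun q a hqa => by
      have : min q.1 k = k + 1 := congrArg Prod.fst hqa
      omega
  have hS := indepFun_of_disjoint_range (fun _ => h.measurable_S _ _ _) h.indep_S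
    (hdisj (Fin m × ℕ))
  have hB := indepFun_of_disjoint_range (fun _ => h.measurable_B _ _) h.indep_B (hdisj (Fin m))
  have hSB := h.indep_B_S.symm.comp
    (φ := fun s => ((fun q : ℕ × Fin m × ℕ => s (min q.1 k, q.2)),
      fun q : Fin m × ℕ => s (k + 1, q)))
    (ψ := fun b => ((fun q : ℕ × Fin m => b (min q.1 k, q.2)), fun i => b (k + 1, i)))
    (by fun_prop) (by fun_prop)
  have hpast := (indepFun_prodMk_prodMk (measurable_pi_lambda _ fun _ => h.measurable_S _ _ _)
    (measurable_pi_lambda _ fun _ => h.measurable_S _ _ _)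
    (measurable_pi_lambda _ fun _ => h.measurable_B _ _)
    (measurable_pi_lambda _ fun _ => h.measurable_B _ _) hS hB hSB).comp
    ((measurable_inputPool k).comp measurable_swap) measurable_id
  have hpool : (fun ω => pool (fun j i => B j i ω) (fun j i r => S j i r ω) k) = fun ω =>
      inputPool k (fun q => B (min q.1 k) q.2 ω, fun q => S (min q.1 k) q.2.1 q.2.2 ω) :=
    funext fun ω => pool_congr (fun j hj => by simp [min_eq_left hj])
      (fun j hj => by simp [min_eq_left hj])
  rw [hpool]
  exact hpast

lemma map_level [IsProbabilityMeasure ν] [NeZero m] (j : ℕ) :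
    P.map (fun ω => ((fun q : Fin m × ℕ => S j q.1 q.2 ω), fun i => B j i ω)) =
      (Measure.infinitePi fun _ : Fin m × ℕ => uniformOn Set.univ).prod
        (Measure.infinitePi fun _ : Fin m => ν) := by
  have := h.indep_B.isProbabilityMeasure
  have hind := h.indep_B_S.symm.comp (φ := fun s (q : Fin m × ℕ) => s (j, q))
    (ψ := fun b (i : Fin m) => b (j, i)) (by fun_prop) (by fun_prop)
  have hS := (h.indep_S.precomp (Prod.mk_right_injective j)).map_fun_eq_infinitePi_map
    fun _ => h.measurable_S _ _ _
  have hB := (h.indep_B.precomp (Prod.mk_right_injective j)).map_fun_eq_infinitePi_map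
    fun _ => h.measurable_B _ _
  simp only [h.law_S, h.law_B] at hS hB
  rw [← hS, ← hB]
  exact (indepFun_iff_map_prod_eq_prod_map_map
    (measurable_pi_lambda _ fun _ => h.measurable_S _ _ _).aemeasurable
    (measurable_pi_lambda _ fun _ => h.measurable_B _ _).aemeasurable).1 hind

lemma map_pool [IsProbabilityMeasure ν] [NeZero m] (k : ℕ) :
    P.map (fun ω => pool (fun j i => B j i ω) (fun j i r => S j i r ω) k) =
      poolLaw ν m k (Fin m) := by
  have := h.indep_B.isProbabilityMeasure
  induction k with
  | zero =>
    have hQ := ((h.indep_B.precomp (Prod.mk_right_injective 0)).comp (fun _ => BranchVec.Q)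
      fun _ => BranchVec.measurable_Q).map_fun_eq_infinitePi_map
        fun _ => BranchVec.measurable_Q.comp (h.measurable_B _ _)
    simp only [← Measure.map_map BranchVec.measurable_Q (h.measurable_B _ _), h.law_B] at hQ
    exact hQ
  | succ k ih =>
    have hlevel : Measurable fun ω =>
        ((fun q : Fin m × ℕ => S (k + 1) q.1 q.2 ω), fun i => B (k + 1) i ω) :=
      (measurable_pi_lambda _ fun _ => h.measurable_S _ _ _).prodMk
        (measurable_pi_lambda _ fun _ => h.measurable_B _ _)
    have hlaw := (indepFun_iff_map_prod_eq_prod_map_map (h.measurable_pool k).aemeasurable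
      hlevel.aemeasurable).1 (h.indepFun_pool_succ k)
    have hdraw : Measurable (Prod.map (fun p : (Fin m → ℝ) × (Fin m × ℕ → Fin m) => p.1 ∘ p.2)
        (id : (Fin m → BranchVec) → Fin m → BranchVec)) :=
      measurable_comp_fin.prodMap measurable_id
    rw [ih, h.map_level] at hlaw
    rw [poolLaw, forestStep, sampleLaw, map_prod_left _ _ measurable_comp_fin,
      (MeasurableEquiv.map_apply_eq_iff_map_symm_apply_eq _).1 Measure.prodAssoc_prod, ← hlaw,
      Measure.map_map measurable_forestMap hdraw,
      Measure.map_map (measurable_forestMap.comp hdraw) MeasurableEquiv.prodAssoc.symm.measurable,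
      Measure.map_map ((measurable_forestMap.comp hdraw).comp
        MeasurableEquiv.prodAssoc.symm.measurable) ((h.measurable_pool k).prodMk hlevel)]
    rfl

end IsBootstrapInput

/-! ### First moments -/

section
variable {ι : Type*}

/-- The quantity `|Q| + ∑_{r ≤ N} |C_r|`, which controls one step of the recursion. -/
noncomputable def BranchVec.size (v : BranchVec) : ℝ≥0 :=
  ‖BranchVec.Q v‖₊ + ∑ r ∈ Finset.range (BranchVec.N v), ‖BranchVec.C v r‖₊

lemma BranchVec.measurable_sum_nnnorm_C : Measurable fun v : BranchVec =>
    ∑ r ∈ Finset.range (BranchVec.N v), ‖BranchVec.C v r‖₊ :=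
  measurable_range_comp (F := fun n v => ∑ r ∈ Finset.range n, ‖BranchVec.C v r‖₊)
    (fun n => by fun_prop) (by fun_prop)

@[fun_prop]
lemma BranchVec.measurable_size : Measurable BranchVec.size :=
  (by fun_prop : Measurable fun v => ‖BranchVec.Q v‖₊).add BranchVec.measurable_sum_nnnorm_C

lemma enorm_branchStep_le (v : BranchVec) (z : ℕ → ℝ) :
    ‖branchStep v z‖ₑ ≤ ‖BranchVec.Q v‖ₑ +
      ∑ r ∈ Finset.range (BranchVec.N v), ‖BranchVec.C v r‖ₑ * ‖z r‖ₑ := by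
  rw [branchStep, add_comm]
  refine (enorm_add_le _ _).trans ?_
  gcongr
  refine (enorm_sum_le _ _).trans_eq ?_
  simp only [enorm_mul]

lemma abs_branchStep_le {v : BranchVec} {z : ℕ → ℝ} {b : ℝ} (hb : 1 ≤ b)
    (hz : ∀ r < BranchVec.N v, |z r| ≤ b) : |branchStep v z| ≤ v.size * b :=
  calc |branchStep v z|
      ≤ (∑ r ∈ Finset.range (BranchVec.N v), |BranchVec.C v r| * |z r|) + |BranchVec.Q v| := by
        refine (abs_add_le _ _).trans ?_
        gcongr
        refine (Finset.abs_sum_le_sum_abs _ _).trans_eq ?_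
        simp only [abs_mul]
    _ ≤ (∑ r ∈ Finset.range (BranchVec.N v), |BranchVec.C v r| * b) + |BranchVec.Q v| * b := by
        gcongr with r hr
        · exact hz r (Finset.mem_range.1 hr)
        · exact le_mul_of_one_le_right (abs_nonneg _) hb
    _ = v.size * b := by
        rw [← Finset.sum_mul, ← add_mul, add_comm, BranchVec.size]
        push_cast
        rfl

lemma lintegral_enorm_branchStep_le {α : Type*} [MeasurableSpace α] {μ : Measure α}
    [IsProbabilityMeasure μ] {Z : α → ℕ → ℝ} (hZ : Measurable Z) {M : ℝ≥0}
    (hM : ∀ r, ∫⁻ a, ‖Z a r‖ₑ ∂μ ≤ M) (v : BranchVec) :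
    ∫⁻ a, ‖branchStep v (Z a)‖ₑ ∂μ ≤ v.size * (1 + M) :=
  calc ∫⁻ a, ‖branchStep v (Z a)‖ₑ ∂μ
      ≤ ∫⁻ a, (‖BranchVec.Q v‖ₑ +
          ∑ r ∈ Finset.range (BranchVec.N v), ‖BranchVec.C v r‖ₑ * ‖Z a r‖ₑ) ∂μ :=
        lintegral_mono fun a => enorm_branchStep_le v (Z a)
    _ = ‖BranchVec.Q v‖ₑ +
          ∑ r ∈ Finset.range (BranchVec.N v), ‖BranchVec.C v r‖ₑ * ∫⁻ a, ‖Z a r‖ₑ ∂μ := by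
        rw [lintegral_add_left measurable_const, lintegral_const, measure_univ, mul_one,
          lintegral_finsetSum _ fun r _ => by fun_prop]
        simp_rw [lintegral_const_mul' _ _ enorm_ne_top]
    _ ≤ ‖BranchVec.Q v‖ₑ * (1 + M) +
          ∑ r ∈ Finset.range (BranchVec.N v), ‖BranchVec.C v r‖ₑ * (1 + M) := by
        gcongr with r
        · exact le_mul_of_one_le_right' le_self_add
        · exact (hM r).trans le_add_self
    _ = v.size * (1 + M) := by
        rw [← Finset.sum_mul, ← add_mul, BranchVec.size]
        push_cast
        rfl

lemma integral_abs_le_of_lintegral_enorm_le {α : Type*} [MeasurableSpace α] {μ : Measure α}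
    {f : α → ℝ} (hf : AEStronglyMeasurable f μ) {M : ℝ≥0} (hM : ∫⁻ a, ‖f a‖ₑ ∂μ ≤ M) :
    ∫ a, |f a| ∂μ ≤ M := by
  have h := ENNReal.toReal_mono ENNReal.coe_ne_top hM
  rwa [← integral_norm_eq_lintegral_enorm hf] at h

/-- All coordinates have first absolute moment at most `M` under `Λ`. -/
def HasMomentBound (Λ : Measure (ι → ℝ)) (M : ℝ≥0) : Prop :=
  ∀ i, ∫⁻ z, ‖z i‖ₑ ∂Λ ≤ M

lemma hasMomentBound_infinitePi {μ : Measure ℝ} [IsProbabilityMeasure μ] {M : ℝ≥0}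
    (hμ : ∫⁻ x, ‖x‖ₑ ∂μ ≤ M) : HasMomentBound (Measure.infinitePi fun _ : ι => μ) M := fun i => by
  rwa [(measurePreserving_eval_infinitePi (fun _ : ι => μ) i).lintegral_comp measurable_enorm]

namespace HasMomentBound

variable {M : ℝ≥0}

lemma integrable_eval {Λ : Measure (ι → ℝ)} (hΛ : HasMomentBound Λ M) (i : ι) :
    Integrable (fun z => z i) Λ :=
  ⟨(measurable_pi_apply i).aestronglyMeasurable, (hΛ i).trans_lt ENNReal.coe_lt_top⟩

lemma integral_abs_le {Λ : Measure (ι → ℝ)} (hΛ : HasMomentBound Λ M) (i : ι) :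
    ∫ z, |z i| ∂Λ ≤ M :=
  integral_abs_le_of_lintegral_enorm_le (measurable_pi_apply i).aestronglyMeasurable (hΛ i)

lemma forestStep {Λ : Measure (ι × ℕ → ℝ)} [IsProbabilityMeasure Λ] (hΛ : HasMomentBound Λ M)
    {ν : Measure BranchVec} [IsProbabilityMeasure ν] {σ : ℝ≥0} (hσ : ∫⁻ v, v.size ∂ν ≤ σ) :
    HasMomentBound (forestStep ν Λ) (σ * (1 + M)) := fun i =>
  calc ∫⁻ y, ‖y i‖ₑ ∂(BranchingBootstrap.forestStep ν Λ)
      = ∫⁻ v : ι → BranchVec, ∫⁻ z : ι × ℕ → ℝ, ‖branchStep (v i) fun r => z (i, r)‖ₑ ∂Λ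
          ∂Measure.infinitePi fun _ => ν := by
        have hmeas : Measurable fun p : (ι × ℕ → ℝ) × (ι → BranchVec) => ‖forestMap p i‖ₑ :=
          ((measurable_pi_apply i).comp measurable_forestMap).enorm
        rw [BranchingBootstrap.forestStep, lintegral_map (by fun_prop) measurable_forestMap,
          lintegral_prod_symm _ hmeas.aemeasurable]
        rfl
    _ ≤ ∫⁻ v : ι → BranchVec, (v i).size * (1 + M) ∂Measure.infinitePi fun _ => ν :=
        lintegral_mono fun v =>
          lintegral_enorm_branchStep_le (by fun_prop) (fun r => hΛ (i, r)) (v i)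
    _ = (∫⁻ v, v.size ∂ν) * (1 + M) := by
        rw [lintegral_mul_const' _ _ (by finiteness),
          (measurePreserving_eval_infinitePi (fun _ : ι => ν) i).lintegral_comp
            (f := fun v => (v.size : ℝ≥0∞)) (by fun_prop)]
    _ ≤ (σ * (1 + M) : ℝ≥0) := by
        push_cast
        gcongr

lemma sampleLaw {m : ℕ} [NeZero m] {π : Measure (Fin m → ℝ)} [SFinite π]
    (hπ : HasMomentBound π M) : HasMomentBound (sampleLaw π ι) M := fun i => by
  have hmeas : Measurable fun p : (Fin m → ℝ) × (ι → Fin m) => ‖(p.1 ∘ p.2) i‖ₑ :=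
    ((measurable_pi_apply i).comp measurable_comp_fin).enorm
  rw [BranchingBootstrap.sampleLaw, lintegral_map (by fun_prop) measurable_comp_fin,
    lintegral_prod_symm _ hmeas.aemeasurable]
  refine (lintegral_mono fun s : ι → Fin m => hπ (s i)).trans ?_
  simp

end HasMomentBound

lemma hasMomentBound_infinitePi_map_Q {ν : Measure BranchVec} [IsProbabilityMeasure ν] {σ : ℝ≥0}
    (hσ : ∫⁻ v, v.size ∂ν ≤ σ) :
    HasMomentBound (Measure.infinitePi fun _ : ι => ν.map BranchVec.Q) σ := by
  have := Measure.isProbabilityMeasure_map (μ := ν) BranchVec.measurable_Q.aemeasurable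
  refine hasMomentBound_infinitePi ?_
  rw [lintegral_map measurable_enorm BranchVec.measurable_Q]
  refine (lintegral_mono fun v => ?_).trans hσ
  rw [BranchVec.size, ENNReal.coe_add]
  exact le_self_add

end

lemma exists_hasMomentBound_poolLaw (ν : Measure BranchVec) [IsProbabilityMeasure ν]
    (hν : ∫⁻ v, v.size ∂ν ≠ ∞) (k : ℕ) :
    ∃ M, ∀ (m : ℕ) [NeZero m] (ι : Type), HasMomentBound (poolLaw ν m k ι) M := by
  lift ∫⁻ v, v.size ∂ν to ℝ≥0 using hν with σ hσ
  induction k with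
  | zero => exact ⟨σ, fun m _ ι => hasMomentBound_infinitePi_map_Q hσ.ge⟩
  | succ k ih =>
    obtain ⟨M, hM⟩ := ih
    exact ⟨σ * (1 + M), fun m _ ι => (hM m (Fin m)).sampleLaw.forestStep hσ.ge⟩

lemma exists_hasMomentBound_treeLaw (ν : Measure BranchVec) [IsProbabilityMeasure ν]
    (hν : ∫⁻ v, v.size ∂ν ≠ ∞) (k : ℕ) :
    ∃ M, ∀ ι : Type, HasMomentBound (Measure.infinitePi fun _ : ι => treeLaw ν k) M := by
  lift ∫⁻ v, v.size ∂ν to ℝ≥0 using hν with σ hσ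
  induction k with
  | zero => exact ⟨σ, fun ι => hasMomentBound_infinitePi_map_Q hσ.ge⟩
  | succ k ih =>
    obtain ⟨M, hM⟩ := ih
    refine ⟨σ * (1 + M), fun ι => ?_⟩
    rw [treeLaw, ← forestStep_infinitePi]
    exact (hM (ι × ℕ)).forestStep hσ.ge

/-! ### Test functions of linear growth -/

/-- The test functions of the propagation of chaos argument: `G` depends on the coordinates in `I`
only and grows at most linearly in them. -/
structure LinearGrowthOn {ι : Type*} (I : Finset ι) (K : ℝ) (G : (ι → ℝ) → ℝ) : Prop where
  measurable : Measurable G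
  dependsOn : DependsOn G I
  abs_le : ∀ z, |G z| ≤ K * (1 + ∑ i ∈ I, |z i|)

lemma integrable_mul_one_add_sum_abs {ι α : Type*} [MeasurableSpace α] {μ : Measure α}
    [IsFiniteMeasure μ] {I : Finset ι} {Z : α → ι → ℝ}
    (hint : ∀ i ∈ I, Integrable (fun a => Z a i) μ) (K : ℝ) :
    Integrable (fun a => K * (1 + ∑ i ∈ I, |Z a i|)) μ :=
  ((integrable_const 1).add (integrable_finsetSum I fun i hi => (hint i hi).abs)).const_mul K

namespace LinearGrowthOn

section
variable {ι : Type*} {I : Finset ι} {K : ℝ} {G : (ι → ℝ) → ℝ} (hG : LinearGrowthOn I K G)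
include hG

lemma nonneg : 0 ≤ K := by
  simpa using (abs_nonneg _).trans (hG.abs_le 0)

section
variable {α : Type*} [MeasurableSpace α] {μ : Measure α} [IsProbabilityMeasure μ]
  {Z : α → ι → ℝ}

lemma integrable_comp (hZ : Measurable Z) (hint : ∀ i ∈ I, Integrable (fun a => Z a i) μ) :
    Integrable (fun a => G (Z a)) μ :=
  (integrable_mul_one_add_sum_abs hint K).mono'
    (hG.measurable.comp hZ).aestronglyMeasurable (.of_forall fun a => hG.abs_le (Z a))

lemma abs_integral_comp_le (hint : ∀ i ∈ I, Integrable (fun a => Z a i) μ) :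
    |∫ a, G (Z a) ∂μ| ≤ K * (1 + ∑ i ∈ I, ∫ a, |Z a i| ∂μ) := by
  refine (norm_integral_le_of_norm_le (f := fun a => G (Z a))
    (integrable_mul_one_add_sum_abs hint K) (.of_forall fun a => hG.abs_le (Z a))).trans_eq ?_
  rw [integral_const_mul, integral_add (integrable_const 1)
    (integrable_finsetSum I fun i hi => (hint i hi).abs),
    integral_finsetSum I fun i hi => (hint i hi).abs]
  simp

end

lemma integrable {Λ : Measure (ι → ℝ)} [IsProbabilityMeasure Λ] {M : ℝ≥0}
    (hΛ : HasMomentBound Λ M) : Integrable G Λ :=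
  hG.integrable_comp measurable_id fun i _ => hΛ.integrable_eval i

lemma abs_integral_comp_right_le {κ : Type*} {Λ : Measure (κ → ℝ)} [IsProbabilityMeasure Λ]
    {M : ℝ≥0} (hΛ : HasMomentBound Λ M) (e : ι → κ) :
    |∫ z, G (z ∘ e) ∂Λ| ≤ K * (1 + I.card * M) := by
  have := hG.nonneg
  refine (hG.abs_integral_comp_le fun i _ => hΛ.integrable_eval (e i)).trans ?_
  gcongr
  rw [← nsmul_eq_mul]
  exact Finset.sum_le_card_nsmul _ _ _ fun i _ => hΛ.integral_abs_le (e i)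

lemma comp_forestMap (v : ι → BranchVec) :
    LinearGrowthOn (I ×ˢ Finset.range (I.sup fun i => BranchVec.N (v i)))
      (K * (1 + ∑ i ∈ I, ((v i).size : ℝ))) fun z => G (forestMap (z, v)) where
  measurable := hG.measurable.comp (measurable_forestMap.comp measurable_prodMk_right)
  dependsOn z z' hz := hG.dependsOn fun i hi => by
    refine congrArg (· + BranchVec.Q (v i)) (Finset.sum_congr rfl fun r hr => ?_)
    have hr' : r < I.sup fun i => BranchVec.N (v i) :=
      (Finset.mem_range.1 hr).trans_le (Finset.le_sup (f := fun i => BranchVec.N (v i)) hi)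
    exact congrArg (BranchVec.C (v i) r * ·)
      (hz (i, r) (Finset.mem_coe.2 (Finset.mk_mem_product hi (Finset.mem_range.2 hr'))))
  abs_le z := by
    set J := I ×ˢ Finset.range (I.sup fun i => BranchVec.N (v i))
    have hK := hG.nonneg
    have hJ_nonneg : 0 ≤ ∑ p ∈ J, |z p| := Finset.sum_nonneg fun p _ => abs_nonneg _
    have hstep (i) (hi : i ∈ I) : |forestMap (z, v) i| ≤ (v i).size * (1 + ∑ p ∈ J, |z p|) := by
      refine abs_branchStep_le (by linarith) fun r hr => ?_
      have hmem : (i, r) ∈ J := Finset.mk_mem_product hi (Finset.mem_range.2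
        (hr.trans_le (Finset.le_sup (f := fun i => BranchVec.N (v i)) hi)))
      linarith [Finset.single_le_sum (fun p _ => abs_nonneg (z p)) hmem]
    calc |G (forestMap (z, v))|
        ≤ K * (1 + ∑ i ∈ I, |forestMap (z, v) i|) := hG.abs_le _
      _ ≤ K * (1 + ∑ i ∈ I, (v i).size * (1 + ∑ p ∈ J, |z p|)) := by
          gcongr with i hi
          exact hstep i hi
      _ ≤ K * (1 + ∑ i ∈ I, ((v i).size : ℝ)) * (1 + ∑ p ∈ J, |z p|) := by
          rw [← Finset.sum_mul, mul_assoc]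
          gcongr
          rw [add_mul, one_mul]
          gcongr
          exact le_add_of_nonneg_right hJ_nonneg

variable {Λ : Measure (ι × ℕ → ℝ)} [IsProbabilityMeasure Λ] {M : ℝ≥0}
  (hΛ : HasMomentBound Λ M)
include hΛ

lemma abs_integral_comp_forestMap_le (v : ι → BranchVec) :
    |∫ z, G (forestMap (z, v)) ∂Λ| ≤ K * (1 + ∑ i ∈ I, ((v i).size : ℝ) * (1 + M)) := by
  have := hG.nonneg
  have hmeas (i : ι) : Measurable fun z : ι × ℕ → ℝ => forestMap (z, v) i :=
    (measurable_pi_apply i).comp (measurable_forestMap.comp measurable_prodMk_right)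
  have hstep (i : ι) : ∫⁻ z, ‖forestMap (z, v) i‖ₑ ∂Λ ≤ ((v i).size * (1 + M) : ℝ≥0) := by
    push_cast
    exact lintegral_enorm_branchStep_le (by fun_prop) (fun r => hΛ (i, r)) (v i)
  refine (hG.abs_integral_comp_le fun i _ => ⟨(hmeas i).aestronglyMeasurable,
    (hstep i).trans_lt ENNReal.coe_lt_top⟩).trans ?_
  gcongr with i
  exact_mod_cast integral_abs_le_of_lintegral_enorm_le (hmeas i).aestronglyMeasurable (hstep i)

lemma integral_forestStep {ν : Measure BranchVec} [IsProbabilityMeasure ν]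
    (hν : ∫⁻ v, v.size ∂ν ≠ ∞) :
    ∫ y, G y ∂forestStep ν Λ =
      ∫ v, ∫ z, G (forestMap (z, v)) ∂Λ ∂Measure.infinitePi fun _ => ν := by
  lift ∫⁻ v, v.size ∂ν to ℝ≥0 using hν with σ hσ
  have hint := (hG.integrable (hΛ.forestStep hσ.ge)).comp_measurable measurable_forestMap
  rw [forestStep, integral_map measurable_forestMap.aemeasurable
    hG.measurable.aestronglyMeasurable]
  exact integral_prod_symm _ hint

end

end LinearGrowthOn

/-- Convergence of the integrals of all test functions of linear growth that depend on finitely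
many coordinates. -/
def FinitaryTendsto {ι : Type*} (Λ : ℕ → Measure (ι → ℝ)) (Λ' : Measure (ι → ℝ)) : Prop :=
  ∀ ⦃I K G⦄, LinearGrowthOn I K G →
    Tendsto (fun m => ∫ z, G z ∂Λ m) atTop (𝓝 (∫ z, G z ∂Λ'))

lemma FinitaryTendsto.forestStep {ι : Type*} {Λ : ℕ → Measure (ι × ℕ → ℝ)}
    {Λ' : Measure (ι × ℕ → ℝ)} [∀ m, IsProbabilityMeasure (Λ m)] [IsProbabilityMeasure Λ']
    (hlim : FinitaryTendsto Λ Λ') {M M' : ℝ≥0} (hΛ : ∀ m, HasMomentBound (Λ m) M)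
    (hΛ' : HasMomentBound Λ' M') {ν : Measure BranchVec} [IsProbabilityMeasure ν]
    (hν : ∫⁻ v, v.size ∂ν ≠ ∞) :
    FinitaryTendsto (fun m => forestStep ν (Λ m)) (forestStep ν Λ') := by
  intro I K G hG
  have hmeas : StronglyMeasurable fun p : (ι × ℕ → ℝ) × (ι → BranchVec) => G (forestMap p) :=
    (hG.measurable.comp measurable_forestMap).stronglyMeasurable
  have hsize : Integrable (fun v : BranchVec => (v.size : ℝ)) ν :=
    ⟨by fun_prop, by simpa [HasFiniteIntegral] using hν.lt_top⟩
  have hbound : Integrable (fun v : ι → BranchVec => K * (1 + ∑ i ∈ I, ((v i).size : ℝ) * (1 + M)))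
      (Measure.infinitePi fun _ => ν) :=
    ((integrable_const 1).add (integrable_finsetSum I fun i _ =>
      ((measurePreserving_eval_infinitePi (fun _ : ι => ν) i).integrable_comp_of_integrable
        hsize).mul_const _)).const_mul K
  rw [hG.integral_forestStep hΛ' hν]
  simp_rw [fun m => hG.integral_forestStep (hΛ m) hν]
  exact tendsto_integral_of_dominated_convergence
    _ (fun m => hmeas.integral_prod_left'.aestronglyMeasurable) hbound
    (fun m => .of_forall (hG.abs_integral_comp_forestMap_le (hΛ m)))
    (.of_forall fun v => hlim (hG.comp_forestMap v))

/-! ### Collisions among the draws -/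

section
variable {m : ℕ} {ι : Type*}

lemma infinitePi_uniformOn_setOf_eq_le [NeZero m] {i j : ι} (hij : i ≠ j) :
    (Measure.infinitePi fun _ : ι => uniformOn (Set.univ : Set (Fin m))) {s | s i = s j} ≤
      (m : ℝ≥0∞)⁻¹ := by
  classical
  have hm : (m : ℝ≥0∞) ≠ 0 := NeZero.ne _
  have hsub : {s : ι → Fin m | s i = s j} ⊆ ⋃ a, ((({i, j} : Finset ι) : Set ι).pi fun _ => {a}) :=
    fun s hs => Set.mem_iUnion.2 ⟨s i, by simp_all⟩
  calc (Measure.infinitePi fun _ : ι => uniformOn (Set.univ : Set (Fin m))) {s | s i = s j}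
      ≤ ∑ a, (Measure.infinitePi fun _ : ι => uniformOn (Set.univ : Set (Fin m)))
          ((({i, j} : Finset ι) : Set ι).pi fun _ => {a}) :=
        (measure_mono hsub).trans (measure_iUnion_fintype_le _ _)
    _ = ∑ _a : Fin m, (m : ℝ≥0∞)⁻¹ * (m : ℝ≥0∞)⁻¹ := by
        refine Finset.sum_congr rfl fun a _ => ?_
        rw [Measure.infinitePi_pi _ fun _ _ => measurableSet_singleton a, Finset.prod_pair hij]
        simp [uniformOn_univ]
    _ = (m : ℝ≥0∞)⁻¹ := by
        rw [Finset.sum_const, Finset.card_univ, Fintype.card_fin, nsmul_eq_mul, ← mul_assoc,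
          ENNReal.mul_inv_cancel hm (ENNReal.natCast_ne_top m), one_mul]

lemma setOf_not_injOn_eq_biUnion (I : Finset ι) : {s : ι → Fin m | ¬ Set.InjOn s I} =
    ⋃ p ∈ I.offDiag, {s | s p.1 = s p.2} := by
  ext s
  simp only [Set.mem_ofPred_eq, Set.InjOn, Set.mem_iUnion, Finset.mem_offDiag, Finset.mem_coe,
    Prod.exists, exists_prop]
  grind

lemma measurableSet_setOf_not_injOn (I : Finset ι) :
    MeasurableSet {s : ι → Fin m | ¬ Set.InjOn s I} := by
  rw [setOf_not_injOn_eq_biUnion]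
  exact Finset.measurableSet_biUnion _ fun p _ =>
    measurableSet_eq_fun (measurable_pi_apply _) (measurable_pi_apply _)

lemma infinitePi_uniformOn_setOf_not_injOn_le [NeZero m] (I : Finset ι) :
    (Measure.infinitePi fun _ : ι => uniformOn Set.univ).real
      {s : ι → Fin m | ¬ Set.InjOn s I} ≤ I.offDiag.card / m := by
  rw [setOf_not_injOn_eq_biUnion]
  refine ENNReal.toReal_le_of_le_ofReal (by positivity) ((measure_biUnion_finset_le _ _).trans ?_)
  rw [ENNReal.ofReal_div_of_pos (by exact_mod_cast NeZero.pos m), ENNReal.ofReal_natCast,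
    ENNReal.ofReal_natCast, ENNReal.div_eq_inv_mul, mul_comm, ← nsmul_eq_mul]
  exact Finset.sum_le_card_nsmul _ _ _ fun p hp =>
    infinitePi_uniformOn_setOf_eq_le (Finset.mem_offDiag.1 hp).2.2

end

lemma integral_comp_eq_of_map_restrict_eq {ι α β : Type*} [MeasurableSpace α] [MeasurableSpace β]
    {I : Finset ι} {G : (ι → ℝ) → ℝ} (hG : Measurable G) (hGI : DependsOn G I) {μ : Measure α}
    {τ : Measure β} {Z : α → ι → ℝ} {W : β → ι → ℝ} (hZ : Measurable Z) (hW : Measurable W)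
    (h : μ.map (fun a (i : I) => Z a i) = τ.map fun b (i : I) => W b i) :
    ∫ a, G (Z a) ∂μ = ∫ b, G (W b) ∂τ := by
  classical
  let extend (y : I → ℝ) (i : ι) : ℝ := if hi : i ∈ I then y ⟨i, hi⟩ else 0
  have hextend : Measurable extend := measurable_pi_lambda _ fun i => by
    by_cases hi : i ∈ I <;> simp only [extend, hi, dite_true, dite_false] <;> fun_prop
  have hG_extend (z : ι → ℝ) : G z = G (extend fun i => z i) :=
    hGI fun i hi => by simp [extend, Finset.mem_coe.1 hi]
  have hmeas : AEStronglyMeasurable (fun y => G (extend y)) (τ.map fun b (i : I) => W b i) :=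
    (hG.comp hextend).aestronglyMeasurable
  simp only [hG_extend (Z _), hG_extend (W _)]
  rw [← integral_map (by fun_prop) hmeas, ← h, integral_map (by fun_prop) (h ▸ hmeas)]

section
variable {m : ℕ} {ι : Type*} {I : Finset ι} {K : ℝ} {G : (ι → ℝ) → ℝ}
  {π : Measure (Fin m → ℝ)} [IsProbabilityMeasure π] {M : ℝ≥0}

lemma LinearGrowthOn.integral_sampleLaw [NeZero m] (hG : LinearGrowthOn I K G)
    (hπ : HasMomentBound π M) :
    ∫ z, G z ∂sampleLaw π ι =
      ∫ s, ∫ x, G (x ∘ s) ∂π ∂Measure.infinitePi fun _ : ι => uniformOn Set.univ := by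
  have hint := (hG.integrable (hπ.sampleLaw (ι := ι))).comp_measurable measurable_comp_fin
  rw [sampleLaw, integral_map measurable_comp_fin.aemeasurable hG.measurable.aestronglyMeasurable]
  exact integral_prod_symm _ hint

variable {Λ : Measure (ι → ℝ)} [IsProbabilityMeasure Λ]

lemma LinearGrowthOn.abs_integral_comp_right_sub_le (hG : LinearGrowthOn I K G)
    (hπ : HasMomentBound π M) (hΛ : HasMomentBound Λ M)
    (heq : ∀ s : ι → Fin m, Set.InjOn s I →
      π.map (fun x (i : I) => x (s i)) = Λ.map fun z (i : I) => z i) (s : ι → Fin m) :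
    |∫ x, G (x ∘ s) ∂π - ∫ z, G z ∂Λ| ≤
      {s : ι → Fin m | ¬ Set.InjOn s I}.indicator (fun _ => 2 * (K * (1 + I.card * M))) s := by
  by_cases hs : Set.InjOn s I
  · rw [Set.indicator_of_notMem (not_not_intro hs), integral_comp_eq_of_map_restrict_eq
      hG.measurable hG.dependsOn (W := id) (by fun_prop) measurable_id (heq s hs)]
    simp
  · rw [Set.indicator_of_mem (by exact hs), two_mul]
    exact (abs_sub _ _).trans
      (add_le_add (hG.abs_integral_comp_right_le hπ s) (hG.abs_integral_comp_right_le hΛ id))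

lemma LinearGrowthOn.abs_integral_sampleLaw_sub_le [NeZero m] (hG : LinearGrowthOn I K G)
    (hπ : HasMomentBound π M) (hΛ : HasMomentBound Λ M)
    (heq : ∀ s : ι → Fin m, Set.InjOn s I →
      π.map (fun x (i : I) => x (s i)) = Λ.map fun z (i : I) => z i) :
    |∫ z, G z ∂sampleLaw π ι - ∫ z, G z ∂Λ| ≤
      2 * (K * (1 + I.card * M)) * (I.offDiag.card / m) := by
  set unif := Measure.infinitePi fun _ : ι => uniformOn (Set.univ : Set (Fin m))
  set D := K * (1 + I.card * M)
  have hD : 0 ≤ D := (abs_nonneg _).trans (hG.abs_integral_comp_right_le hΛ id)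
  have hinner_meas : StronglyMeasurable fun s : ι → Fin m => ∫ x, G (x ∘ s) ∂π :=
    (hG.measurable.comp measurable_comp_fin).stronglyMeasurable.integral_prod_left'
  have hinner_int : Integrable (fun s => ∫ x, G (x ∘ s) ∂π) unif :=
    .of_bound hinner_meas.aestronglyMeasurable D
      (.of_forall fun s => hG.abs_integral_comp_right_le hπ s)
  calc |∫ z, G z ∂sampleLaw π ι - ∫ z, G z ∂Λ|
      = ‖∫ s, (∫ x, G (x ∘ s) ∂π - ∫ z, G z ∂Λ) ∂unif‖ := by
        rw [integral_sub hinner_int (integrable_const _), hG.integral_sampleLaw hπ, integral_const,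
          probReal_univ, one_smul, Real.norm_eq_abs]
    _ ≤ ∫ s, {s : ι → Fin m | ¬ Set.InjOn s I}.indicator (fun _ => 2 * D) s ∂unif :=
        norm_integral_le_of_norm_le
          ((integrable_const _).indicator (measurableSet_setOf_not_injOn I))
          (.of_forall fun s => hG.abs_integral_comp_right_sub_le hπ hΛ heq s)
    _ = 2 * D * unif.real {s | ¬ Set.InjOn s I} := by
        rw [integral_indicator_const _ (measurableSet_setOf_not_injOn I), smul_eq_mul, mul_comm]
    _ ≤ 2 * D * (I.offDiag.card / m) := by
        gcongr
        exact infinitePi_uniformOn_setOf_not_injOn_le I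

end

section
variable {ι : Type} {ν : Measure BranchVec} [IsProbabilityMeasure ν]

lemma poolLaw_map_restrict {m : ℕ} [NeZero m] (k : ℕ) {I : Finset ι} {s : ι → Fin m}
    (hs : Set.InjOn s I) : (poolLaw ν m k (Fin m)).map (fun x (i : I) => x (s i)) =
      (poolLaw ν m k ι).map fun z (i : I) => z i :=
  (poolLaw_map_comp ν k hs.injective).trans (poolLaw_map_comp ν k Subtype.val_injective).symm

lemma FinitaryTendsto.sampleLaw_poolLaw (hν : ∫⁻ v, v.size ∂ν ≠ ∞) {k : ℕ} {Λ : Measure (ι → ℝ)}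
    (hlim : FinitaryTendsto (fun m => poolLaw ν (m + 1) k ι) Λ) :
    FinitaryTendsto (fun m => sampleLaw (poolLaw ν (m + 1) k (Fin (m + 1))) ι) Λ := by
  intro I K G hG
  obtain ⟨M, hM⟩ := exists_hasMomentBound_poolLaw ν hν k
  have hrate : Tendsto (fun m : ℕ => 2 * (K * (1 + I.card * M)) *
      (I.offDiag.card / ((m + 1 : ℕ) : ℝ))) atTop (𝓝 0) := by
    simpa using ((tendsto_const_div_atTop_nhds_zero_nat (I.offDiag.card : ℝ)).comp
      (tendsto_add_atTop_nat 1)).const_mul (2 * (K * (1 + I.card * M)))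
  refine tendsto_of_tendsto_of_dist (hlim hG)
    (squeeze_zero (fun _ => dist_nonneg) (fun m => ?_) hrate)
  rw [dist_comm]
  exact hG.abs_integral_sampleLaw_sub_le (hM (m + 1) _) (hM (m + 1) _) fun s hs =>
    poolLaw_map_restrict k hs

lemma finitaryTendsto_poolLaw (hν : ∫⁻ v, v.size ∂ν ≠ ∞) (k : ℕ) :
    FinitaryTendsto (fun m => poolLaw ν (m + 1) k ι) (Measure.infinitePi fun _ => treeLaw ν k) := by
  induction k generalizing ι with
  | zero => exact fun _ _ _ _ => tendsto_const_nhds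
  | succ k ih =>
    obtain ⟨M, hM⟩ := exists_hasMomentBound_poolLaw ν hν k
    obtain ⟨M', hM'⟩ := exists_hasMomentBound_treeLaw ν hν k
    rw [treeLaw, ← forestStep_infinitePi]
    exact (ih.sampleLaw_poolLaw hν).forestStep (fun m => (hM (m + 1) _).sampleLaw) (hM' _) hν

end

/-! ### The empirical mean of a pool -/

/-- The average of `f` over the values `x` of a pool. -/
noncomputable def empiricalMean {m : ℕ} (f : ℝ → ℝ) (x : Fin m → ℝ) : ℝ :=
  (1 / (m : ℝ)) * ∑ i, f (x i)

section
variable {m : ℕ} {f : ℝ → ℝ}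

@[fun_prop]
lemma measurable_empiricalMean (hf : Measurable f) :
    Measurable (empiricalMean f : (Fin m → ℝ) → ℝ) := by
  unfold empiricalMean
  fun_prop

lemma memLp_empiricalMean {π : Measure (Fin m → ℝ)} {p : ℝ≥0∞}
    (hf : ∀ i, MemLp (fun x => f (x i)) p π) : MemLp (empiricalMean f) p π :=
  (memLp_finsetSum _ fun i _ => hf i).const_mul _

lemma integrable_empiricalMean {π : Measure (Fin m → ℝ)}
    (hf : ∀ i, Integrable (fun x => f (x i)) π) :
    Integrable (empiricalMean f) π :=
  memLp_one_iff_integrable.1 (memLp_empiricalMean fun i => memLp_one_iff_integrable.2 (hf i))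

lemma abs_empiricalMean_le (f : ℝ → ℝ) (x : Fin m → ℝ) :
    |empiricalMean f x| ≤ empiricalMean (fun y => |f y|) x := by
  rw [empiricalMean, empiricalMean, abs_mul, abs_of_nonneg (by positivity)]
  gcongr
  exact Finset.abs_sum_le_sum_abs _ _

lemma empiricalMean_sub (f g : ℝ → ℝ) (x : Fin m → ℝ) :
    empiricalMean (fun y => f y - g y) x = empiricalMean f x - empiricalMean g x := by
  simp only [empiricalMean, Finset.sum_sub_distrib, mul_sub]

lemma integral_uniformOn_univ (g : Fin m → ℝ) :
    ∫ i, g i ∂uniformOn Set.univ = (1 / (m : ℝ)) * ∑ i, g i := by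
  rw [integral_fintype .of_finite, Finset.mul_sum]
  refine Finset.sum_congr rfl fun i _ => ?_
  simp [measureReal_def, uniformOn_univ]

lemma abs_empiricalMean_sub_le (f g : ℝ → ℝ) (c d : ℝ) (x : Fin m → ℝ) :
    |empiricalMean f x - d| ≤
      empiricalMean (fun y => |f y - g y|) x + |empiricalMean g x - c| + |c - d| := by
  have hsplit : empiricalMean f x - d =
      empiricalMean (fun y => f y - g y) x + (empiricalMean g x - c) + (c - d) := by
    rw [empiricalMean_sub]
    ring
  rw [hsplit]
  refine (abs_add_three _ _ _).trans ?_
  gcongr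
  exact abs_empiricalMean_le _ x

lemma integral_abs_empiricalMean_sub_le {π : Measure (Fin m → ℝ)} [IsProbabilityMeasure π]
    {g : ℝ → ℝ} (hf : ∀ i, Integrable (fun x => f (x i)) π)
    (hg : ∀ i, Integrable (fun x => g (x i)) π) (c d : ℝ) :
    ∫ x, |empiricalMean f x - d| ∂π ≤
      ∫ x, empiricalMean (fun y => |f y - g y|) x ∂π + ∫ x, |empiricalMean g x - c| ∂π +
        |c - d| := by
  have hdiff : Integrable (empiricalMean fun y => |f y - g y|) π :=
    integrable_empiricalMean fun i => ((hf i).sub (hg i)).abs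
  have hfluct := ((integrable_empiricalMean hg).sub (integrable_const c)).abs
  refine (integral_mono ((integrable_empiricalMean hf).sub (integrable_const d)).abs
    ((hdiff.add hfluct).add (integrable_const |c - d|))
    (abs_empiricalMean_sub_le f g c d)).trans_eq ?_
  rw [integral_add' (hdiff.add hfluct) (integrable_const _), integral_add' hdiff hfluct]
  simp

variable [NeZero m]

/-- Given the pool, draws with replacement are independent and uniform over its values. -/
lemma integral_prod_sampleLaw {ι : Type*} [Fintype ι] (hf : Measurable f)
    {π : Measure (Fin m → ℝ)} [IsProbabilityMeasure π]
    (hint : Integrable (fun z => ∏ i, f (z i)) (sampleLaw π ι)) :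
    ∫ z, ∏ i, f (z i) ∂sampleLaw π ι = ∫ x, empiricalMean f x ^ Fintype.card ι ∂π := by
  have hmeas : Measurable fun z : ι → ℝ => ∏ i, f (z i) := by fun_prop
  rw [sampleLaw, integral_map measurable_comp_fin.aemeasurable hmeas.aestronglyMeasurable]
  refine (integral_prod _ (hint.comp_measurable measurable_comp_fin)).trans ?_
  refine integral_congr_ae (.of_forall fun x => ?_)
  simp only [Function.comp_apply]
  rw [Measure.infinitePi_eq_pi, integral_fintype_prod_eq_pow fun j => f (x j),
    integral_uniformOn_univ]
  rfl

lemma empiricalMean_sub_const (f : ℝ → ℝ) (c : ℝ) (x : Fin m → ℝ) :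
    empiricalMean (fun y => f y - c) x = empiricalMean f x - c := by
  have : (m : ℝ) ≠ 0 := NeZero.ne _
  simp only [empiricalMean, Finset.sum_sub_distrib, Finset.sum_const, Finset.card_univ,
    Fintype.card_fin, nsmul_eq_mul]
  field_simp

end

lemma LinearGrowthOn.eval {ι : Type*} {f : ℝ → ℝ} (hf : Measurable f) {K : ℝ}
    (hK : ∀ x, |f x| ≤ K * (1 + |x|)) (i : ι) : LinearGrowthOn {i} K fun z => f (z i) where
  measurable := by fun_prop
  dependsOn z z' h := congrArg f (h i (by simp))
  abs_le z := by simpa using hK (z i)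

lemma abs_prod_le_pow_card {ι : Type*} [Fintype ι] {a : ι → ℝ} {b : ℝ} (hb : ∀ i, |a i| ≤ b) :
    |∏ i, a i| ≤ b ^ Fintype.card ι := by
  rw [Finset.abs_prod, ← Finset.card_univ, ← Finset.prod_const]
  exact Finset.prod_le_prod (fun i _ => abs_nonneg _) fun i _ => hb i

lemma LinearGrowthOn.prod_of_abs_le {ι : Type*} [Fintype ι] {f : ℝ → ℝ} (hf : Measurable f)
    {b : ℝ} (hb : ∀ x, |f x| ≤ b) :
    LinearGrowthOn Finset.univ (b ^ Fintype.card ι) fun z : ι → ℝ => ∏ i, f (z i) where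
  measurable := by fun_prop
  dependsOn z z' h := by simp_all
  abs_le z := by
    have hb_nonneg : 0 ≤ b := (abs_nonneg _).trans (hb 0)
    refine (abs_prod_le_pow_card fun i => hb (z i)).trans
      (le_mul_of_one_le_right (by positivity) ?_)
    exact le_add_of_nonneg_right (Finset.sum_nonneg fun i _ => abs_nonneg _)

lemma integral_abs_le_sqrt_integral_sq {α : Type*} [MeasurableSpace α] {μ : Measure α}
    [IsProbabilityMeasure μ] {f : α → ℝ} (hf : MemLp f 2 μ) :
    ∫ a, |f a| ∂μ ≤ √(∫ a, f a ^ 2 ∂μ) := by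
  have h := variance_nonneg |f| μ
  rw [variance_eq_sub hf.abs] at h
  exact Real.le_sqrt_of_sq_le (by simpa [sq_abs] using h)

section
variable {π : (m : ℕ) → Measure (Fin (m + 1) → ℝ)} [∀ m, IsProbabilityMeasure (π m)]
  {μ : Measure ℝ} [IsProbabilityMeasure μ] {f : ℝ → ℝ}

lemma tendsto_integral_abs_empiricalMean_of_integral_eq_zero
    (hlim : FinitaryTendsto (fun m => sampleLaw (π m) (Fin 2)) (Measure.infinitePi fun _ => μ))
    (hf : Measurable f) {b : ℝ} (hb : ∀ x, |f x| ≤ b) (hmean : ∫ x, f x ∂μ = 0) :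
    Tendsto (fun m => ∫ x, |empiricalMean f x| ∂π m) atTop (𝓝 0) := by
  have hprod := LinearGrowthOn.prod_of_abs_le (ι := Fin 2) hf hb
  have hint (m : ℕ) : Integrable (fun z : Fin 2 → ℝ => ∏ i, f (z i)) (sampleLaw (π m) (Fin 2)) :=
    .of_bound hprod.measurable.aestronglyMeasurable _
      (.of_forall fun z => abs_prod_le_pow_card fun i => hb (z i))
  have hsq : Tendsto (fun m => ∫ x, empiricalMean f x ^ 2 ∂π m) atTop (𝓝 0) := by
    have := hlim hprod
    simp_rw [integral_prod_sampleLaw hf (hint _)] at this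
    rw [Measure.infinitePi_eq_pi, integral_fintype_prod_eq_pow f, hmean] at this
    simpa using this
  have hmem (m : ℕ) : MemLp (empiricalMean f) 2 (π m) :=
    memLp_empiricalMean fun i => .of_bound
      (hf.comp (measurable_pi_apply i)).aestronglyMeasurable b (.of_forall fun x => hb (x i))
  refine squeeze_zero (fun m => integral_nonneg fun x => abs_nonneg _)
    (fun m => integral_abs_le_sqrt_integral_sq (hmem m)) ?_
  simpa using hsq.sqrt

lemma tendsto_integral_abs_empiricalMean_sub_of_abs_le
    (hlim : FinitaryTendsto (fun m => sampleLaw (π m) (Fin 2)) (Measure.infinitePi fun _ => μ))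
    (hf : Measurable f) {b : ℝ} (hb : ∀ x, |f x| ≤ b) :
    Tendsto (fun m => ∫ x, |empiricalMean f x - ∫ y, f y ∂μ| ∂π m) atTop (𝓝 0) := by
  have hint : Integrable f μ := .of_bound hf.aestronglyMeasurable b (.of_forall hb)
  simp_rw [← empiricalMean_sub_const]
  refine tendsto_integral_abs_empiricalMean_of_integral_eq_zero hlim (by fun_prop)
    (fun x => (abs_sub _ _).trans (add_le_add_left (hb x) _)) ?_
  rw [integral_sub hint (integrable_const _)]
  simp

lemma tendsto_integral_empiricalMean
    (hlim : FinitaryTendsto (fun m => sampleLaw (π m) (Fin 1)) (Measure.infinitePi fun _ => μ))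
    (hf : Measurable f) {K : ℝ} (hK : ∀ x, |f x| ≤ K * (1 + |x|))
    {M : ℝ≥0} (hπ : ∀ m, HasMomentBound (π m) M) :
    Tendsto (fun m => ∫ x, empiricalMean f x ∂π m) atTop (𝓝 (∫ x, f x ∂μ)) := by
  have hG := LinearGrowthOn.eval hf hK (0 : Fin 1)
  have h := hlim hG
  rw [Measure.infinitePi_eq_pi, integral_comp_eval hf.aestronglyMeasurable] at h
  refine h.congr fun m => ?_
  have hint := hG.integrable (hπ m).sampleLaw
  simpa using integral_prod_sampleLaw (ι := Fin 1) hf (by simpa using hint)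

lemma tendsto_integral_abs_empiricalMean_sub
    (hlim : ∀ n, FinitaryTendsto (fun m => sampleLaw (π m) (Fin n)) (Measure.infinitePi fun _ => μ))
    (hf : Measurable f) {K : ℝ} (hK : ∀ x, |f x| ≤ K * (1 + |x|)) (hint : Integrable f μ)
    {M : ℝ≥0} (hπ : ∀ m, HasMomentBound (π m) M) :
    Tendsto (fun m => ∫ x, |empiricalMean f x - ∫ y, f y ∂μ| ∂π m) atTop (𝓝 0) := by
  refine tendsto_order.2 ⟨fun a ha => .of_forall fun m =>
    ha.trans_le (integral_nonneg fun x => abs_nonneg _), fun a ha => ?_⟩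
  obtain ⟨g, hg, hg_int⟩ := hint.exists_boundedContinuous_integral_sub_le (div_pos ha three_pos)
  have hg_meas : Measurable g := g.continuous.measurable
  have hg_le (x : ℝ) : |g x| ≤ ‖g‖ := g.norm_coe_le_norm x
  have hdiff_le (x : ℝ) : |(|f x - g x|)| ≤ (K + ‖g‖) * (1 + |x|) := by
    rw [abs_abs, add_mul]
    refine (abs_sub _ _).trans (add_le_add (hK x) ((hg_le x).trans ?_))
    exact le_mul_of_one_le_right (norm_nonneg _) (le_add_of_nonneg_right (abs_nonneg _))
  have hdiff := tendsto_integral_empiricalMean (hlim 1) (by fun_prop) hdiff_le hπ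
  have hfluct := tendsto_integral_abs_empiricalMean_sub_of_abs_le (hlim 2) hg_meas hg_le
  have hmean : |∫ y, g y ∂μ - ∫ y, f y ∂μ| ≤ ∫ x, |f x - g x| ∂μ := by
    rw [abs_sub_comm, ← integral_sub hint hg_int]
    exact norm_integral_le_integral_norm fun x => f x - g x
  have hlt : ∫ x, |f x - g x| ∂μ + 0 + |∫ y, g y ∂μ - ∫ y, f y ∂μ| < a := by
    simp only [Real.norm_eq_abs] at hg
    linarith
  filter_upwards [((hdiff.add hfluct).add_const _).eventually_lt_const hlt] with m hm
  refine (integral_abs_empiricalMean_sub_le (fun i => ?_) (fun i => ?_) _ _).trans_lt hm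
  · exact (LinearGrowthOn.eval hf hK i).integrable (hπ m)
  · exact .of_bound (hg_meas.comp (measurable_pi_apply i)).aestronglyMeasurable ‖g‖
      (.of_forall fun x => hg_le (x i))

end

section
variable {ν : Measure BranchVec} [IsProbabilityMeasure ν]

lemma integrable_treeLaw (hν : ∫⁻ v, v.size ∂ν ≠ ∞) {f : ℝ → ℝ} (hf : Measurable f) {K : ℝ}
    (hK : ∀ x, |f x| ≤ K * (1 + |x|)) (k : ℕ) : Integrable f (treeLaw ν k) := by
  obtain ⟨M, hM⟩ := exists_hasMomentBound_treeLaw ν hν k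
  exact ((measurePreserving_eval_infinitePi (fun _ : Unit => treeLaw ν k) ()).integrable_comp
    hf.aestronglyMeasurable).1 ((LinearGrowthOn.eval hf hK ()).integrable (hM Unit))

lemma tendsto_integral_abs_empiricalMean_poolLaw (hν : ∫⁻ v, v.size ∂ν ≠ ∞) {f : ℝ → ℝ}
    (hf : Measurable f) {K : ℝ} (hK : ∀ x, |f x| ≤ K * (1 + |x|)) (k : ℕ) :
    Tendsto (fun m : ℕ => ∫ x, |empiricalMean f x - ∫ y, f y ∂treeLaw ν k|
      ∂poolLaw ν (m + 1) k (Fin (m + 1))) atTop (𝓝 0) := by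
  obtain ⟨M, hM⟩ := exists_hasMomentBound_poolLaw ν hν k
  exact tendsto_integral_abs_empiricalMean_sub
    (fun n => (finitaryTendsto_poolLaw hν k).sampleLaw_poolLaw hν) hf hK
    (integrable_treeLaw hν hf hK k) fun m => hM (m + 1) _

end

/-! ### Convergence of the estimator -/

lemma lintegral_size_ne_top {ν : Measure BranchVec} (hQ : Integrable BranchVec.Q ν)
    (hC : Integrable (fun v => ∑ r ∈ Finset.range (BranchVec.N v), |BranchVec.C v r|) ν) :
    ∫⁻ v, v.size ∂ν ≠ ∞ := by
  have h : Integrable (fun v : BranchVec => (v.size : ℝ)) ν :=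
    (hQ.abs.add hC).congr (.of_forall fun v => by simp [BranchVec.size])
  simpa [HasFiniteIntegral] using h.2.ne

lemma integrable_of_lintegral_rpow_lt_top {α : Type*} [MeasurableSpace α] {μ : Measure α}
    [IsFiniteMeasure μ] {f : α → ℝ} (hf : AEStronglyMeasurable f μ) {β : ℝ} (hβ : 1 ≤ β)
    (h : ∫⁻ a, ENNReal.ofReal (|f a| ^ β) ∂μ < ∞) : Integrable f μ := by
  have hβ_pos : 0 < β := one_pos.trans_le hβ
  have hmem : MemLp f (ENNReal.ofReal β) μ := by
    refine (integrable_norm_rpow_iff hf (by simpa) ENNReal.ofReal_ne_top).1 ?_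
    rw [ENNReal.toReal_ofReal hβ_pos.le]
    refine ⟨(hf.norm.aemeasurable.pow_const β).aestronglyMeasurable, ?_⟩
    rw [hasFiniteIntegral_iff_ofReal (.of_forall fun a => by positivity)]
    exact h
  exact hmem.integrable (by simpa)

namespace MomentConditions

variable {ν : Measure BranchVec} [IsFiniteMeasure ν] {β : ℝ} (h : MomentConditions ν β)
include h

lemma integrable_Q : Integrable BranchVec.Q ν :=
  integrable_of_lintegral_rpow_lt_top BranchVec.measurable_Q.aestronglyMeasurable h.one_le
    h.moment_Q

lemma integrable_sum_abs_C :
    Integrable (fun v => ∑ r ∈ Finset.range (BranchVec.N v), |BranchVec.C v r|) ν := by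
  have hmeas : Measurable fun v => ∑ r ∈ Finset.range (BranchVec.N v), |BranchVec.C v r| := by
    simpa using BranchVec.measurable_sum_nnnorm_C.coe_nnreal_real
  refine integrable_of_lintegral_rpow_lt_top hmeas.aestronglyMeasurable h.one_le ?_
  simpa only [Finset.abs_sum_of_nonneg' fun _ => abs_nonneg _] using h.moment_C

end MomentConditions

lemma tendstoInMeasure_of_tendsto_integral_abs_sub {α : Type*} [MeasurableSpace α]
    {μ : Measure α} {f : ℕ → α → ℝ} {g : α → ℝ} (hf : ∀ n, Integrable (f n) μ)
    (hg : Integrable g μ) (hlim : Tendsto (fun n => ∫ a, |f n a - g a| ∂μ) atTop (𝓝 0)) :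
    TendstoInMeasure μ f atTop g := by
  refine tendstoInMeasure_of_tendsto_eLpNorm one_ne_zero (fun n => (hf n).aestronglyMeasurable)
    hg.aestronglyMeasurable ?_
  have hnorm (n : ℕ) : eLpNorm (f n - g) 1 μ = ENNReal.ofReal (∫ a, |f n a - g a| ∂μ) := by
    rw [eLpNorm_one_eq_lintegral_enorm, ← ofReal_integral_norm_eq_lintegral_enorm ((hf n).sub hg)]
    rfl
  simpa [hnorm] using ENNReal.tendsto_ofReal hlim

section
variable {ν : Measure BranchVec} [IsProbabilityMeasure ν] {f : ℝ → ℝ} {K : ℝ}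

namespace IsBootstrapInput

variable {Ω : Type*} [MeasurableSpace Ω] {P : Measure Ω}

lemma integrable_poolAverage {m : ℕ} {B : ℕ → Fin m → Ω → BranchVec}
    {S : ℕ → Fin m → ℕ → Ω → Fin m} (h : IsBootstrapInput P ν B S) (hν : ∫⁻ v, v.size ∂ν ≠ ∞)
    (hf : Measurable f) (hK : ∀ x, |f x| ≤ K * (1 + |x|)) (k : ℕ) :
    Integrable (poolAverage f k B S) P := by
  obtain ⟨M, hM⟩ := exists_hasMomentBound_poolLaw ν hν k
  refine (integrable_finsetSum _ fun i _ => ?_).const_mul _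
  have : NeZero m := ⟨i.pos.ne'⟩
  have hint := (LinearGrowthOn.eval hf hK i).integrable (hM m (Fin m))
  rw [← h.map_pool] at hint
  exact hint.comp_measurable (h.measurable_pool k)

lemma tendsto_integral_abs_poolAverage_sub {B : (m : ℕ) → ℕ → Fin m → Ω → BranchVec}
    {S : (m : ℕ) → ℕ → Fin m → ℕ → Ω → Fin m} (h : ∀ m, IsBootstrapInput P ν (B m) (S m))
    (hν : ∫⁻ v, v.size ∂ν ≠ ∞) (hf : Measurable f) (hK : ∀ x, |f x| ≤ K * (1 + |x|)) (k : ℕ) :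
    Tendsto (fun m => ∫ ω, |poolAverage f k (B m) (S m) ω - ∫ y, f y ∂treeLaw ν k| ∂P) atTop
      (𝓝 0) := by
  refine (tendsto_add_atTop_iff_nat 1).1
    ((tendsto_integral_abs_empiricalMean_poolLaw hν hf hK k).congr fun m => ?_)
  rw [← (h (m + 1)).map_pool, integral_map ((h (m + 1)).measurable_pool k).aemeasurable
    (by fun_prop)]
  rfl

end IsBootstrapInput

end

end BranchingBootstrap

open BranchingBootstrap in
theorem mainTheorem2_general
    (ν : Measure BranchVec) [IsProbabilityMeasure ν] (hQ : Integrable BranchVec.Q ν)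
    (hC : Integrable (fun v => ∑ r ∈ Finset.range (BranchVec.N v), |BranchVec.C v r|) ν)
    {Ω' : Type*} [MeasurableSpace Ω'] (P' : Measure Ω') (V : List ℕ → Ω' → BranchVec)
    (hV : IsBranchingFamily P' ν V) {Ω : Type*} [MeasurableSpace Ω] (P : Measure Ω)
    (B : (m : ℕ) → ℕ → Fin m → Ω → BranchVec) (S : (m : ℕ) → ℕ → Fin m → ℕ → Ω → Fin m)
    (hBS : ∀ m, IsBootstrapInput P ν (B m) (S m)) (h : ℝ → ℝ) (hmeas : Measurable h) (C : ℝ)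
    (hgrowth : ∀ x, |h x| ≤ C * (1 + |x|)) (k : ℕ) :
    Integrable (fun ω' => h (treeSum (fun i => V i ω') k)) P' ∧
    (∀ m, Integrable (poolAverage h k (B m) (S m)) P) ∧
    Tendsto (fun m => ∫ ω, |poolAverage h k (B m) (S m) ω
        - ∫ ω', h (treeSum (fun i => V i ω') k) ∂P'| ∂P) atTop (𝓝 0) ∧
    TendstoInMeasure P (fun m => poolAverage h k (B m) (S m)) atTop
      (fun _ => ∫ ω', h (treeSum (fun i => V i ω') k) ∂P') := by
  have hν := lintegral_size_ne_top hQ hC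
  have := (hBS 0).indep_B.isProbabilityMeasure
  have htree := hV.measurePreserving_treeSum k
  have hmean : ∫ ω', h (treeSum (fun i => V i ω') k) ∂P' = ∫ y, h y ∂treeLaw ν k :=
    htree.hasLaw.integral_comp hmeas.aestronglyMeasurable
  have hpool (m : ℕ) := (hBS m).integrable_poolAverage hν hmeas hgrowth k
  have hlim := IsBootstrapInput.tendsto_integral_abs_poolAverage_sub hBS hν hmeas hgrowth k
  rw [hmean]
  exact ⟨htree.integrable_comp_of_integrable (integrable_treeLaw hν hmeas hgrowth k), hpool, hlim,
    tendstoInMeasure_of_tendsto_integral_abs_sub hpool (integrable_const _) hlim⟩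

theorem mainTheorem2
    (ν : Measure BranchingBootstrap.BranchVec) [IsProbabilityMeasure ν]
    (β : ℝ) (hβ : 1 < β) (hν : BranchingBootstrap.MomentConditions ν β)
    -- a weighted branching process with generic branching vector of law `ν`
    {Ω' : Type*} [MeasurableSpace Ω'] (P' : Measure Ω') [IsProbabilityMeasure P']
    (V : List ℕ → Ω' → BranchingBootstrap.BranchVec)
    (hV : BranchingBootstrap.IsBranchingFamily P' ν V)
    -- for every pool size `m`, a run of the algorithm; no assumption relates different `m`
    {Ω : Type*} [MeasurableSpace Ω] (P : Measure Ω) [IsProbabilityMeasure P]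
    (B : (m : ℕ) → ℕ → Fin m → Ω → BranchingBootstrap.BranchVec)
    (S : (m : ℕ) → ℕ → Fin m → ℕ → Ω → Fin m)
    (hBS : ∀ m, BranchingBootstrap.IsBootstrapInput P ν (B m) (S m))
    (h : ℝ → ℝ) (hcont : Continuous h) (C : ℝ) (hC : 0 < C)
    (hgrowth : ∀ x, |h x| ≤ C * (1 + |x|)) (k : ℕ) :
    Integrable (fun ω' => h (BranchingBootstrap.treeSum (fun i => V i ω') k)) P' ∧
    (∀ m, Integrable (BranchingBootstrap.poolAverage h k (B m) (S m)) P) ∧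
    Tendsto (fun m => ∫ ω, |BranchingBootstrap.poolAverage h k (B m) (S m) ω
        - ∫ ω', h (BranchingBootstrap.treeSum (fun i => V i ω') k) ∂P'| ∂P) atTop (𝓝 0) ∧
    TendstoInMeasure P (fun m => BranchingBootstrap.poolAverage h k (B m) (S m)) atTop
      (fun _ => ∫ ω', h (BranchingBootstrap.treeSum (fun i => V i ω') k) ∂P') :=
  mainTheorem2_general ν hν.integrable_Q hν.integrable_sum_abs_C P' V hV P B S hBS h
    hcont.measurable C hgrowth k
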